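/- Let $p$ be a prime, $\Bbbk$ a field of characteristic $p$, $V$ a finite-dimensional $\Bbbk$-vector space and $G\subseteq \mathrm{GL}(V)$ a finite $p$-group, acting on $V^*$ by $(gx)(v)=x(g^{-1}v)$. Let $\mathcal B=(x_1,\ldots,x_n)$ be an ordered basis of $V^*$, and extend the action of $G$ on $V^*$ to $\Bbbk$-algebra automorphisms of $S=\operatorname{Sym}V^*=\Bbbk[x_1,\ldots,x_n]$. Let $S^G$ be the invariant ring and $\mathfrak h_{G,S}=(S^G)_+S$ the Hilbert ideal, i.e. the ideal of $S$ generated by all invariants of positive degree. For $g\in G$ put $\beta_g=\max\{j \mid x_j \text{ appears in } gx_i-x_i\text{ for some }i\}$ (and $\beta_g=0$ if $g=1$). The group $G$ is called a generalised Nakajima group with respect to $\mathcal B$ if 1. $gx_i-x_i\in\Bbbk\langle x_1,\ldots,x_{i-1}\rangle$ for all $g\in G$ and all $i=1,\ldots,n$, and 2. there are integers $1\le i_0<i_1<\cdots<i_r\le n$ with $r<n$ such that $G$ is generated by $P_1\cup\cdots\cup P_r$, where $P_k$ is the subgroup of $G$ generated by $$\{g\in G\mid \text{if } gx_i\ne x_i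 \text{ then } i_{k-1}<i\le i_k \text{ and } \beta_g\le i_{k-1}\}.$$ **Theorem.** Let $G$ be a generalised Nakajima group with respect to a basis $\mathcal B=\{x_1,\ldots,x_n\}$ of $V^*$. Then the Hilbert ideal $\mathfrak h_{G,S}$ is a complete intersection, i.e. it is a homogeneous ideal minimally generated by $\operatorname{height}(\mathfrak h_{G,S})$ elements. Moreover, it is generated by a set of homogeneous elements $\{f_1,\ldots,f_n\}$ such that, for each $j$, $f_j\in\Bbbk[x_1,\ldots,x_j]$, $\deg(f_j)\le|G|$, and $x_j^{\deg(f_j)}$ is a term of $f_j$ (i.e. occurs in $f_j$ with nonzero coefficient). -/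

import Mathlib

namespace GenNakajima

noncomputable section

attribute [local instance] MvPolynomial.gradedAlgebra

variable {k V : Type*} [Field k] [AddCommGroup V] [Module k V] {n : ℕ}

/-- The contragredient action of `GL(V)` on `V^*`: `(g x)(v) = x (g⁻¹ v)`. -/
def dualAct (g : LinearMap.GeneralLinearGroup k V) (x : Module.Dual k V) : Module.Dual k V :=
  x ∘ₗ ((g⁻¹ : LinearMap.GeneralLinearGroup k V) : V →ₗ[k] V)

/-- The inclusion of `V^*` as the linear forms of the polynomial ring
`S = Sym V^* = k[x₁, …, xₙ]`, where `x₁, …, xₙ` is the given basis of `V^*`. -/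
def linearForm (B : Module.Basis (Fin n) k (Module.Dual k V)) :
    Module.Dual k V →ₗ[k] MvPolynomial (Fin n) k :=
  B.constr k (fun i => (MvPolynomial.X i : MvPolynomial (Fin n) k))

/-- The action of `g` on `S = k[x₁, …, xₙ]`: the `k`-algebra endomorphism of `S` extending the
action of `g` on `V^*`. -/
def polyAct (B : Module.Basis (Fin n) k (Module.Dual k V))
    (g : LinearMap.GeneralLinearGroup k V) :
    MvPolynomial (Fin n) k →ₐ[k] MvPolynomial (Fin n) k :=
  MvPolynomial.aeval (fun i => linearForm B (dualAct g (B i)))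

/-- The ring of invariants `S^G`. -/
def invariants (G : Subgroup (LinearMap.GeneralLinearGroup k V))
    (B : Module.Basis (Fin n) k (Module.Dual k V)) :
    Subalgebra k (MvPolynomial (Fin n) k) where
  carrier := {f | ∀ g ∈ G, polyAct B g f = f}
  mul_mem' := fun ha hb g hg => by rw [map_mul, ha g hg, hb g hg]
  add_mem' := fun ha hb g hg => by rw [map_add, ha g hg, hb g hg]
  algebraMap_mem' := fun c g _ => AlgHom.commutes _ c

/-- The Hilbert ideal `(S^G)₊ S`; here `(S^G)₊` consists of the invariants without
constant term. -/
def hilbertIdeal (G : Subgroup (LinearMap.GeneralLinearGroup k V))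
    (B : Module.Basis (Fin n) k (Module.Dual k V)) : Ideal (MvPolynomial (Fin n) k) :=
  Ideal.span {f | f ∈ invariants G B ∧ MvPolynomial.constantCoeff f = 0}

/-- A homogeneous ideal `I` of the polynomial ring is a complete intersection if it is
minimally generated by `height I` elements. -/
def IsCompleteIntersection {σ : Type*} (I : Ideal (MvPolynomial σ k)) : Prop :=
  I.IsHomogeneous (MvPolynomial.homogeneousSubmodule σ k) ∧
    ∃ s : Finset (MvPolynomial σ k),
      Ideal.span (s : Set (MvPolynomial σ k)) = I ∧
      (∀ t : Finset (MvPolynomial σ k), t ⊂ s → Ideal.span (t : Set (MvPolynomial σ k)) ≠ I) ∧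
      (s.card : ℕ∞) = I.height

open Classical in
/-- `β_g`, the largest `j` (counted from `1`) such that `x_j` appears in `g x_i - x_i` for
some `i`; it is `0` if there is no such `j`. -/
def beta (B : Module.Basis (Fin n) k (Module.Dual k V))
    (g : LinearMap.GeneralLinearGroup k V) : ℕ :=
  (Finset.univ.filter (fun j : Fin n => ∃ i : Fin n, B.repr (dualAct g (B i) - B i) j ≠ 0)).sup
    (fun j => (j : ℕ) + 1)

/-- The subgroup of `G` generated by those `g ∈ G` that move `x_i` only for `a < i ≤ b` and
satisfy `β_g ≤ a` (indices counted from `1`, so that `B j` is `x_{j+1}`). -/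
def blockSubgroup (G : Subgroup (LinearMap.GeneralLinearGroup k V))
    (B : Module.Basis (Fin n) k (Module.Dual k V)) (a b : ℕ) :
    Subgroup (LinearMap.GeneralLinearGroup k V) :=
  Subgroup.closure {g | g ∈ G ∧
    ∀ j : Fin n, dualAct g (B j) ≠ B j → (a < (j : ℕ) + 1 ∧ (j : ℕ) + 1 ≤ b) ∧ beta B g ≤ a}

/-- `G` is a generalised Nakajima group with respect to the ordered basis `B = (x₁, …, xₙ)`
of `V^*`: the action is unitriangular in `B`, and for some sequence
`1 ≤ i₀ < i₁ < ⋯ < i_r ≤ n` with `r < n` the group `G` is generated by `P₁ ∪ ⋯ ∪ P_r`, where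
`P_k` is the block subgroup of `G` for the interval `i_{k-1} < i ≤ i_k`. -/
def IsGeneralisedNakajima (G : Subgroup (LinearMap.GeneralLinearGroup k V))
    (B : Module.Basis (Fin n) k (Module.Dual k V)) : Prop :=
  ∃ (r : ℕ) (i : Fin (r + 1) → ℕ),
    r < n ∧ StrictMono i ∧ 1 ≤ i 0 ∧ i (Fin.last r) ≤ n ∧
    (∀ g ∈ G, ∀ j : Fin n,
      dualAct g (B j) - B j ∈ Submodule.span k (B '' {l : Fin n | l < j})) ∧
    Subgroup.closure
      (⋃ m : Fin r, (blockSubgroup G B (i m.castSucc) (i m.succ) :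
        Set (LinearMap.GeneralLinearGroup k V))) = G

end

end GenNakajima

/-!
The Hilbert ideal `𝔥` of a generalised Nakajima group is generated by power forms
`f_j = ∑_{i ≤ j} a_i x_i ^ (p ^ e_j)` with `a_j = 1`.

The break points `i₀ < ⋯ < i_r` divide the variables into levels. The group acts on a variable by
adding linear forms in variables of lower levels, and it is generated by elements that move the
variables of a single level. Consequently translations of the variables `y` of level `l` commute
with the action on polynomials in variables of level at most `l`, and setting `y = 0` preserves
invariance. Expanding an invariant as `f(x, y) = ∑ D_γ(x, 0) y^γ`, with coefficients that are
invariants of lower level, gives `f(x, y) ≡ f(0, y)` modulo invariants of lower level without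
constant term (`sub_levelPart_mem`). So `𝔥` is generated by the polynomials `F - F(0)`, where `F`
runs over the family of all `f(0, y)`; this family is stable under Hasse derivatives, that is, under
taking the coefficients of `F(x + c)` in `c`.

An ideal generated by such a family is the ideal of an infinitesimal subgroup scheme of a vector
group, and these are defined by additive polynomials (`exists_powerForm_generators`). The elementary
proof is an induction on the degree of `F`. Let `f_j` be a power form in `𝔥` with leading variable
`x_j` and least exponent. By induction the Hasse derivatives of `F` of positive order are constants
modulo `J = (f_1, …, f_n)`; since reduced polynomials are linearly independent modulo `J`
(`IsReduced.eq_zero_of_mem`), the remainder of `F` modulo `J` is an additive polynomial plus a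
constant (`sub_constantCoeff_mem_span`), and its homogeneous components are power forms in `𝔥`,
hence in `J` (`powerForm_mem_span`).

The product of all `g x_j` shows `x_j ^ |G| ∈ 𝔥`
(`exists_invariant_levelPart_eq_X_pow`), which bounds the exponents `e_j`. It also shows that `𝔥` has
height `n`, so its `n` generators are minimal in number by Krull's height theorem
(`isCompleteIntersection_of_X_pow_mem`).
-/

namespace GenNakajima
open MvPolynomial

noncomputable section

attribute [local instance] MvPolynomial.gradedAlgebra

/-! ### Triangular power forms and reduced polynomials -/

section PowerForms

variable {R : Type*} [CommRing R] {n : ℕ}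

/-- The form `∑ᵢ aᵢ xᵢ ^ m`. For `m` a power of the characteristic these are the homogeneous
additive polynomials. -/
def powerForm {σ : Type*} [Fintype σ] (m : ℕ) (a : σ → R) : MvPolynomial σ R :=
  ∑ i, C (a i) * X i ^ m

/-- No monomial of `F` is divisible by any of the powers `x_j ^ q j`. -/
def IsReduced {σ : Type*} (q : σ → ℕ) (F : MvPolynomial σ R) : Prop :=
  ∀ d ∈ F.support, ∀ j, d j < q j

lemma finSuccEquiv_powerForm (m : ℕ) (a : Fin (n + 1) → R) :
    finSuccEquiv R n (powerForm m a) =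
      Polynomial.C (C (a 0)) * Polynomial.X ^ m +
        Polynomial.C (powerForm m (fun i => a i.succ)) := by
  simp [powerForm, Fin.sum_univ_succ, finSuccEquiv_apply]

lemma IsReduced.coeff_finSuccEquiv {q : Fin (n + 1) → ℕ} {F : MvPolynomial (Fin (n + 1)) R}
    (hF : IsReduced q F) (i : ℕ) :
    IsReduced (fun j => q j.succ) ((finSuccEquiv R n F).coeff i) := by
  intro d hd j
  simpa using hF _ (mem_support_coeff_finSuccEquiv.1 hd) j.succ

lemma finSuccEquiv_lead_monic (m : ℕ) (hm : 0 < m) (a : Fin (n + 1) → R) (ha : a 0 = 1) :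
    (finSuccEquiv R n (powerForm m a)).Monic := by
  rw [finSuccEquiv_powerForm, ha]
  simp only [map_one, one_mul]
  exact Polynomial.monic_X_pow_add_C _ hm.ne'

/-- Division with remainder by power forms with leading terms `x_j ^ q j`, where `x₀` is the most
significant variable: divide by the form that is monic in `x₀`, then reduce the coefficients. -/
lemma exists_isReduced_aux (n : ℕ) : ∀ (q : Fin n → ℕ) (_ : ∀ j, 0 < q j)
    (a : Fin n → Fin n → R) (_ : ∀ j, a j j = 1) (_ : ∀ j i, i < j → a j i = 0)
    (F : MvPolynomial (Fin n) R),
    ∃ F', IsReduced q F' ∧ F - F' ∈ Ideal.span (Set.range fun j => powerForm (q j) (a j)) := by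
  induction n with
  | zero => exact fun q _ a _ _ F => ⟨F, fun d _ j => j.elim0, by simp⟩
  | succ n ih =>
    intro q hq a h1 h0 F
    set I := Ideal.span (Set.range fun j => powerForm (q j) (a j)) with hI
    set e := finSuccEquiv R n with he
    set f0 := e (powerForm (q 0) (a 0)) with hf0
    have hmon : f0.Monic := finSuccEquiv_lead_monic _ (hq 0) _ (h1 0)
    choose r hr1 hr2 using fun P => ih (fun j => q j.succ) (fun j => hq _)
      (fun j i => a j.succ i.succ) (fun j => h1 _) (fun j i hij => h0 _ _ (by simpa using hij)) P
    have hC : ∀ P ∈ Ideal.span (Set.range fun j : Fin n =>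
        powerForm (q j.succ) (fun i : Fin n => a j.succ i.succ)),
        e.symm (Polynomial.C P) ∈ I := by
      intro P hP
      have : Ideal.span (Set.range fun j : Fin n =>
        powerForm (q j.succ) (fun i : Fin n => a j.succ i.succ)) ≤
          I.comap ((e.symm : _ →+* MvPolynomial (Fin (n+1)) R).comp Polynomial.C) := by
        rw [Ideal.span_le]
        rintro _ ⟨j, rfl⟩
        have : e (powerForm (q j.succ) (a j.succ)) =
          Polynomial.C (powerForm (q j.succ) (fun i : Fin n => a j.succ i.succ)) := by
          rw [he, finSuccEquiv_powerForm, h0 _ _ (Fin.succ_pos j)]; simp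
        simp only [SetLike.mem_coe, Ideal.mem_comap, RingHom.comp_apply]
        rw [← this]
        have h5 : powerForm (q j.succ) (a j.succ) ∈ I :=
          Ideal.subset_span (Set.mem_range_self j.succ)
        simpa using h5
      exact this hP
    set P := e F %ₘ f0 with hP
    have hdeg : f0.natDegree ≤ q 0 := by
      rw [hf0, he, finSuccEquiv_powerForm]
      compute_degree
    let P' : Polynomial (MvPolynomial (Fin n) R) :=
      ∑ i ∈ Finset.range (q 0), Polynomial.C (r (P.coeff i)) * Polynomial.X ^ i
    have hPsum : P = ∑ i ∈ Finset.range (q 0), Polynomial.C (P.coeff i) * Polynomial.X ^ i := by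
      nontriviality R
      refine Polynomial.as_sum_range_C_mul_X_pow' (p := P) (n := q 0) ?_
      have hne : f0 ≠ 1 := by
        intro h
        have h2 : f0.natDegree = q 0 := by
          rw [hf0, he, finSuccEquiv_powerForm, h1]
          simp only [map_one, one_mul]
          exact Polynomial.natDegree_X_pow_add_C
        rw [h] at h2
        simp at h2
        exact (hq 0).ne h2
      exact (Polynomial.natDegree_modByMonic_lt _ hmon hne).trans_le hdeg
    refine ⟨e.symm P', ?_, ?_⟩
    · intro d hd
      have hd' : d.tail ∈ (P'.coeff (d 0)).support := by
        have := mem_support_coeff_finSuccEquiv (f := e.symm P') (i := d 0) (m := d.tail)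
        rw [← he, AlgEquiv.apply_symm_apply, Finsupp.cons_tail] at this
        exact this.2 hd
      have hc : P'.coeff (d 0) = if d 0 < q 0 then r (P.coeff (d 0)) else 0 := by
        simp [P', Polynomial.finsetSum_coeff, Polynomial.coeff_X_pow]
      rw [hc] at hd'
      split_ifs at hd' with h
      · intro j
        refine Fin.cases h (fun j => ?_) j
        simpa [Finsupp.tail_apply] using hr1 _ _ hd' j
      · simp at hd'
    · have h1 : F - e.symm P' = e.symm (e F /ₘ f0) * powerForm (q 0) (a 0) +
          ∑ i ∈ Finset.range (q 0), e.symm (Polynomial.C (P.coeff i - r (P.coeff i))) *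
            e.symm (Polynomial.X ^ i) := by
        apply e.injective
        simp only [map_sub, map_add, map_mul, map_sum, AlgEquiv.apply_symm_apply, ← hf0]
        simp only [sub_mul, Finset.sum_sub_distrib]
        have h6 := Polynomial.modByMonic_add_div (e F) f0
        rw [← hP] at h6
        have h7 : P' = ∑ i ∈ Finset.range (q 0),
          Polynomial.C (r (P.coeff i)) * Polynomial.X ^ i := rfl
        rw [← hPsum, ← h7]
        linear_combination -h6
      rw [h1]
      refine add_mem (I.mul_mem_left _ (Ideal.subset_span ⟨0, rfl⟩)) (sum_mem fun i _ =>
        I.mul_mem_right _ (hC _ (hr2 _)))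

lemma dvd_map_of_mem_span {A B : Type*} [CommRing A] [CommRing B] (ψ : A →+* B) {s : Set A}
    {c : B} (h : ∀ x ∈ s, c ∣ ψ x) {F : A} (hF : F ∈ Ideal.span s) : c ∣ ψ F := by
  have hle : Ideal.span s ≤ (Ideal.span {c}).comap ψ :=
    Ideal.span_le.2 fun x hx => Ideal.mem_comap.2 (Ideal.mem_span_singleton.2 (h x hx))
  exact Ideal.mem_span_singleton.1 (Ideal.mem_comap.1 (hle hF))

/-- Uniqueness of the remainder: modulo the forms in the remaining variables, a reduced element of the
ideal is a multiple of a monic polynomial in `x₀` of larger degree, so all its coefficients lie in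
the ideal of those forms. -/
lemma eq_zero_of_isReduced_aux (n : ℕ) : ∀ (q : Fin n → ℕ) (_ : ∀ j, 0 < q j)
    (a : Fin n → Fin n → R) (_ : ∀ j, a j j = 1) (_ : ∀ j i, i < j → a j i = 0)
    (F : MvPolynomial (Fin n) R), IsReduced q F →
    F ∈ Ideal.span (Set.range fun j => powerForm (q j) (a j)) → F = 0 := by
  induction n with
  | zero => 
    intro q _ a _ _ F _ hF
    simpa using hF
  | succ n ih =>
    intro q hq a h1 h0 F hred hF
    set e := finSuccEquiv R n with he
    set J := Ideal.span (Set.range fun j : Fin n =>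
        powerForm (q j.succ) (fun i : Fin n => a j.succ i.succ)) with hJ
    -- The quotient is kept abstract, which keeps unification away from its instances.
    obtain ⟨Q, _, π, hπ⟩ : ∃ (Q : Type _) (_ : CommRing Q) (π : MvPolynomial (Fin n) R →+* Q),
        ∀ x, π x = 0 ↔ x ∈ J :=
      ⟨_, inferInstance, Ideal.Quotient.mk J, fun _ => Ideal.Quotient.eq_zero_iff_mem⟩
    set φ := Polynomial.mapRingHom π with hφ
    set f0 := e (powerForm (q 0) (a 0)) with hf0
    have hmon : f0.Monic := finSuccEquiv_lead_monic _ (hq 0) _ (h1 0)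
    have hdvd : φ f0 ∣ φ (e F) := by
      refine dvd_map_of_mem_span (φ.comp (e : _ →+* Polynomial (MvPolynomial (Fin n) R))) ?_ hF
      rintro _ ⟨j, rfl⟩
      simp only [RingHom.comp_apply]
      refine Fin.cases (dvd_refl _) (fun j => ?_) j
      have h3 : e (powerForm (q j.succ) (a j.succ)) =
          Polynomial.C (powerForm (q j.succ) (fun i : Fin n => a j.succ i.succ)) := by
        rw [he, finSuccEquiv_powerForm, h0 _ _ (Fin.succ_pos j)]; simp
      have h4 : φ (e (powerForm (q j.succ) (a j.succ))) = 0 := by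
        rw [h3, hφ, Polynomial.coe_mapRingHom, Polynomial.map_C,
          (hπ _).2 (Ideal.subset_span (Set.mem_range_self j)), map_zero]
      exact (dvd_zero _).trans (dvd_of_eq h4.symm)
    have hzero : φ (e F) = 0 := by
      rcases subsingleton_or_nontrivial Q with _ | _
      · exact Subsingleton.elim _ _
      by_contra hne
      refine (hmon.map _).not_dvd_of_degree_lt hne ?_ hdvd
      have hd : (f0.map π).degree = q 0 := by
        rw [hf0, he, finSuccEquiv_powerForm, h1]
        simp only [map_one, one_mul, Polynomial.map_add, Polynomial.map_pow, Polynomial.map_X,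
          Polynomial.map_C]
        exact Polynomial.degree_X_pow_add_C (hq 0) _
      rw [hd, Polynomial.degree_lt_iff_coeff_zero]
      intro i hi
      have : (e F).coeff i = 0 := by
        ext d
        by_contra h
        have h5 := hred _ (mem_support_coeff_finSuccEquiv.1 (mem_support_iff.2 h)) 0
        simp at h5
        omega
      simp [hφ, this]
    apply e.injective
    rw [map_zero]
    ext1 i
    rw [Polynomial.coeff_zero]
    refine ih (fun j => q j.succ) (fun j => hq _)
      (fun j i => a j.succ i.succ) (fun j => h1 _) (fun j i hij => h0 _ _ (by simpa using hij)) _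
      (hred.coeff_finSuccEquiv i) ?_
    have := congrArg (fun P => Polynomial.coeff P i) hzero
    simpa [hφ, hπ] using this

lemma rename_rev_powerForm (m : ℕ) (a : Fin n → R) :
    rename Fin.rev (powerForm m a) = powerForm m (fun i => a i.rev) := by
  simp only [powerForm, map_sum, map_mul, rename_C, map_pow, rename_X]
  exact Fintype.sum_equiv Fin.revPerm _ _ (by simp)

lemma IsReduced.rename_rev {q : Fin n → ℕ} {F : MvPolynomial (Fin n) R} (hF : IsReduced q F) :
    IsReduced (fun j => q j.rev) (rename Fin.rev F) := by
  classical
  intro d hd j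
  rw [support_rename_of_injective Fin.rev_injective, Finset.mem_image] at hd
  obtain ⟨d', hd', rfl⟩ := hd
  have := Finsupp.mapDomain_apply Fin.rev_injective d' j.rev
  rw [Fin.rev_rev] at this
  rw [this]
  exact hF _ hd' _

lemma rename_rev_mem {q : Fin n → ℕ} {a : Fin n → Fin n → R} {F : MvPolynomial (Fin n) R}
    (hF : F ∈ Ideal.span (Set.range fun j => powerForm (q j) (a j))) :
    rename Fin.rev F ∈
      Ideal.span (Set.range fun j : Fin n => powerForm (q j.rev) (fun i => a j.rev i.rev)) := by
  have : Ideal.span (Set.range fun j => powerForm (q j) (a j)) ≤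
      (Ideal.span (Set.range fun j : Fin n => powerForm (q j.rev) (fun i => a j.rev i.rev))).comap
        (rename Fin.rev : MvPolynomial (Fin n) R →ₐ[R] _) := by
    rw [Ideal.span_le]
    rintro _ ⟨j, rfl⟩
    simp only [SetLike.mem_coe, Ideal.mem_comap, rename_rev_powerForm]
    exact Ideal.subset_span ⟨j.rev, by simp⟩
  exact this hF

lemma rename_rev_rename_rev (F : MvPolynomial (Fin n) R) :
    rename Fin.rev (rename Fin.rev F) = F := by
  rw [rename_rename, Fin.rev_involutive.comp_self, rename_id_apply]

/-- Every polynomial has a reduced representative modulo a triangular family of power forms. -/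
theorem exists_isReduced (q : Fin n → ℕ) (hq : ∀ j, 0 < q j)
    (a : Fin n → Fin n → R) (h1 : ∀ j, a j j = 1) (h0 : ∀ j i, j < i → a j i = 0)
    (F : MvPolynomial (Fin n) R) :
    ∃ F', IsReduced q F' ∧ F - F' ∈ Ideal.span (Set.range fun j => powerForm (q j) (a j)) := by
  obtain ⟨F', h, h'⟩ := exists_isReduced_aux n (fun j => q j.rev) (fun j => hq _)
    (fun j i => a j.rev i.rev) (fun j => h1 _) (fun j i hij => h0 _ _ (Fin.rev_lt_rev.2 hij))
    (rename Fin.rev F)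
  refine ⟨rename Fin.rev F', by simpa using h.rename_rev, ?_⟩
  have h2 := rename_rev_mem h'
  rw [map_sub, rename_rev_rename_rev] at h2
  simpa only [Fin.rev_rev] using h2

/-- A reduced polynomial in the ideal of a triangular family of power forms vanishes. The base ring is
arbitrary, since this is also applied over the quotient of the polynomial ring by that ideal. -/
theorem IsReduced.eq_zero_of_mem {q : Fin n → ℕ} (hq : ∀ j, 0 < q j)
    {a : Fin n → Fin n → R} (h1 : ∀ j, a j j = 1) (h0 : ∀ j i, j < i → a j i = 0)
    {F : MvPolynomial (Fin n) R} (hF : IsReduced q F)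
    (hmem : F ∈ Ideal.span (Set.range fun j => powerForm (q j) (a j))) : F = 0 := by
  apply rename_injective _ Fin.rev_injective
  rw [map_zero]
  exact eq_zero_of_isReduced_aux n (fun j => q j.rev) (fun j => hq _)
    (fun j i => a j.rev i.rev) (fun j => h1 _) (fun j i hij => h0 _ _ (Fin.rev_lt_rev.2 hij)) _
    hF.rename_rev (rename_rev_mem hmem)

end PowerForms

/-! ### Translations and additive polynomials -/

section Translation

variable {R : Type*} [CommRing R] {σ : Type*}

/-- The translation `f(x) ↦ f(x + c)`. The outer variables of the target are the `c_j`, so that the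
coefficients of `translate f` are the Hasse derivatives of `f`. -/
def translate : MvPolynomial σ R →ₐ[R] MvPolynomial σ (MvPolynomial σ R) :=
  aeval fun j => C (X j) + X j

@[simp] lemma translate_X (j : σ) : translate (X j : MvPolynomial σ R) = C (X j) + X j :=
  aeval_X _ _

@[simp] lemma translate_C (r : R) : translate (C r : MvPolynomial σ R) = C (C r) :=
  aeval_C _ _

/-- The Hasse derivative of order `γ` takes `x ^ (β + γ)` to a product of binomial coefficients times
`x ^ β`. -/
lemma coeff_coeff_translate [Fintype σ] (F : MvPolynomial σ R) (β γ : σ →₀ ℕ) :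
    coeff β (coeff γ (translate F)) = (∏ j, ((β j + γ j).choose (γ j) : R)) * coeff (β + γ) F := by
  classical
  induction F using MvPolynomial.induction_on' with
  | add p q hp hq => simp only [map_add, coeff_add, hp, hq, mul_add]
  | monomial α r =>
    have key : translate (monomial α r) = ∑ s ∈ Fintype.piFinset fun j => Finset.range (α j + 1),
        monomial (Finsupp.equivFunOnFinite.symm s)
          (monomial (Finsupp.equivFunOnFinite.symm fun j => α j - s j)
            (r * ∏ j, ((α j).choose (s j) : R))) := by
      rw [translate, aeval_monomial, Finsupp.prod_fintype _ _ (by simp)]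
      simp only [add_comm (C _) (X _), add_pow]
      rw [Finset.prod_univ_sum, Finset.mul_sum]
      refine Finset.sum_congr rfl fun s _ => ?_
      rw [Finset.prod_mul_distrib, Finset.prod_mul_distrib]
      rw [monomial_eq, monomial_eq, Finsupp.prod_fintype _ _ (by simp),
        Finsupp.prod_fintype _ _ (by simp)]
      simp only [MvPolynomial.algebraMap_apply, algebraMap_eq, Finsupp.equivFunOnFinite_symm_apply_apply,
        map_mul, map_prod, map_pow, map_natCast]
      ring
    rw [key]
    simp only [coeff_sum, coeff_monomial]
    by_cases h : α = β + γ
    · subst h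
      rw [Finset.sum_eq_single (γ : σ → ℕ)]
      · rw [if_pos (by ext; simp), coeff_monomial, if_pos (by ext; simp), if_pos rfl, mul_comm]
        simp
      · intro s _ hs
        rw [if_neg]
        · simp
        · rintro h
          apply hs
          ext j
          rw [← h]; simp
      · intro h
        exact absurd (Fintype.mem_piFinset.2 fun j => by simp) h
    · rw [if_neg h, mul_zero]
      refine Finset.sum_eq_zero fun s hs => ?_
      split_ifs with h1
      · rw [coeff_monomial, if_neg]
        rintro rfl
        apply h
        ext j
        have := Finset.mem_range.1 (Fintype.mem_piFinset.1 hs j)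
        rw [← h1]
        simp
        omega
      · simp

lemma add_mem_support_of_coeff_coeff_translate [Fintype σ] {F : MvPolynomial σ R} {β γ : σ →₀ ℕ}
    (h : coeff β (coeff γ (translate F)) ≠ 0) : β + γ ∈ F.support := by
  rw [mem_support_iff]
  rw [coeff_coeff_translate] at h
  exact right_ne_zero_of_mul h

@[simp] lemma coeff_zero_translate [Fintype σ] (F : MvPolynomial σ R) :
    coeff 0 (translate F) = F := by
  ext β
  simp [coeff_coeff_translate]

@[simp] lemma coeff_zero_coeff_translate [Fintype σ] (F : MvPolynomial σ R) (γ : σ →₀ ℕ) :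
    coeff 0 (coeff γ (translate F)) = coeff γ F := by
  simp [coeff_coeff_translate]

/-- If `m` is not a power of `p`, some inner binomial coefficient of row `m` is prime to `p`: writing
`m = p ^ v * u` with `u` prime to `p`, the coefficient of `X ^ (p ^ v)` in `(X + 1) ^ m` is `u`. -/
lemma exists_choose_ne_zero {k : Type*} [Field k] (p : ℕ) [hp : Fact p.Prime] [CharP k p] {m : ℕ}
    (hm : m ≠ 0) (h : ∀ e, m ≠ p ^ e) :
    ∃ i, 0 < i ∧ i < m ∧ ((m.choose i : ℕ) : k) ≠ 0 := by
  obtain ⟨v, u, hu, rfl⟩ := Nat.exists_eq_pow_mul_and_not_dvd hm p hp.out.ne_one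
  have hu0 : u ≠ 0 := by rintro rfl; simp at hu
  have hu1 : u ≠ 1 := by rintro rfl; exact h v (by simp)
  have hpv : 0 < p ^ v := pow_pos hp.out.pos v
  refine ⟨p ^ v, hpv, ?_, ?_⟩
  · exact lt_mul_of_one_lt_right hpv (by omega)
  · have h1 : ((Polynomial.X + 1 : Polynomial k) ^ (p ^ v * u)).coeff (p ^ v) = (u : k) := by
      rw [pow_mul, add_pow_char_pow, one_pow]
      have : ((Polynomial.X ^ p ^ v + 1 : Polynomial k) ^ u) =
          Polynomial.expand k (p ^ v) ((Polynomial.X + 1) ^ u) := by simp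
      rw [this]
      have h2 := Polynomial.coeff_expand_mul hpv ((Polynomial.X + 1 : Polynomial k) ^ u) 1
      rw [one_mul] at h2
      rw [h2, Polynomial.coeff_X_add_one_pow, Nat.choose_one_right]
    rw [Polynomial.coeff_X_add_one_pow] at h1
    rw [h1, Ne, CharP.cast_eq_zero_iff k p]
    exact hu

/-- Over a field of characteristic `p`, a polynomial with `F(x + c) = F(x) + F(c)` up to a constant
involves, besides the constant, only the monomials `x_j ^ (p ^ e)`. -/
theorem support_of_additive {k : Type*} [Field k] (p : ℕ) [hp : Fact p.Prime] [CharP k p]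
    [Fintype σ] {F : MvPolynomial σ k}
    (hF : ∀ β γ : σ →₀ ℕ, β ≠ 0 → γ ≠ 0 → coeff β (coeff γ (translate F)) = 0)
    {α : σ →₀ ℕ} (hα : α ∈ F.support) (hα0 : α ≠ 0) :
    ∃ j e, α = Finsupp.single j (p ^ e) := by
  classical
  obtain ⟨j, hj⟩ := Finsupp.ne_iff.1 hα0
  simp only [Finsupp.coe_zero, Pi.zero_apply] at hj
  have hα' := mem_support_iff.1 hα
  have h1 : α.erase j = 0 := by
    by_contra hne
    have h2 := hF (α.erase j) (Finsupp.single j (α j)) hne (by simpa using hj)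
    rw [coeff_coeff_translate, Finsupp.erase_add_single] at h2
    refine (mul_ne_zero ?_ hα') h2
    refine Finset.prod_ne_zero_iff.2 fun i _ => ?_
    by_cases hij : i = j
    · subst hij; simp
    · simp [Finsupp.single_eq_of_ne hij]
  have hs : α = Finsupp.single j (α j) := by
    conv_lhs => rw [← Finsupp.erase_add_single j α, h1, zero_add]
  by_contra hcon
  push Not at hcon
  obtain ⟨i, hi, him, hne⟩ := exists_choose_ne_zero (k := k) p hj (fun e he => hcon j e (he ▸ hs))
  have h2 := hF (Finsupp.single j (α j - i)) (Finsupp.single j i) (by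
    rw [Ne, Finsupp.single_eq_zero]; exact (Nat.sub_pos_of_lt him).ne') (by
    rw [Ne, Finsupp.single_eq_zero]; exact hi.ne')
  rw [coeff_coeff_translate, ← Finsupp.single_add, Nat.sub_add_cancel him.le, ← hs] at h2
  refine (mul_ne_zero ?_ hα') h2
  refine Finset.prod_ne_zero_iff.2 fun l _ => ?_
  by_cases hij : l = j
  · subst hij; simpa [Nat.sub_add_cancel him.le] using hne
  · simp [Finsupp.single_eq_of_ne hij]

end Translation

/-! ### Translation-stable families and power forms -/

section PowerFormOperations

variable {R : Type*} [CommRing R] {σ : Type*} [Fintype σ]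

lemma map_powerForm {S : Type*} [CommRing S] (π : R →+* S) (m : ℕ) (a : σ → R) :
    map π (powerForm m a) = powerForm m (fun i => π (a i)) := by
  simp [powerForm]

lemma powerForm_sub_C_mul (m : ℕ) (a b : σ → R) (c : R) :
    powerForm m (fun i => a i - c * b i) = powerForm m a - C c * powerForm m b := by
  simp only [powerForm, Finset.mul_sum, ← Finset.sum_sub_distrib]
  refine Finset.sum_congr rfl fun i _ => ?_
  simp only [map_sub, map_mul]
  ring

lemma constantCoeff_powerForm {m : ℕ} (hm : m ≠ 0) (a : σ → R) :
    constantCoeff (powerForm m a) = 0 := by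
  simp [powerForm, hm]

lemma powerForm_isHomogeneous (m : ℕ) (a : σ → R) : (powerForm m a).IsHomogeneous m :=
  IsHomogeneous.sum _ _ _ fun _ _ => isHomogeneous_C_mul_X_pow _ _ _

lemma powerForm_single [DecidableEq σ] (m : ℕ) (j : σ) :
    powerForm m (Pi.single j (1 : R)) = X j ^ m := by
  rw [powerForm, Finset.sum_eq_single j] <;> simp +contextual

lemma coeff_powerForm {m : ℕ} (hm : m ≠ 0) (a : σ → R) (j : σ) :
    coeff (Finsupp.single j m) (powerForm m a) = a j := by
  classical
  rw [powerForm, coeff_sum, Finset.sum_eq_single j]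
  · simp [coeff_C_mul, coeff_X_pow]
  · intro i _ hij
    rw [coeff_C_mul, coeff_X_pow, if_neg, mul_zero]
    rw [Finsupp.single_left_inj hm]
    exact hij
  · simp

variable (p : ℕ) [hp : Fact p.Prime] [CharP R p]

lemma powerForm_pow (m s : ℕ) (a : σ → R) :
    powerForm m a ^ p ^ s = powerForm (m * p ^ s) (fun i => a i ^ p ^ s) := by
  rw [powerForm, sum_pow_char_pow]
  simp [powerForm, mul_pow, pow_mul]

lemma translate_powerForm (e : ℕ) (a : σ → R) :
    translate (powerForm (p ^ e) a) =
      C (powerForm (p ^ e) a) + map C (powerForm (p ^ e) a) := by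
  simp only [powerForm, map_sum, map_mul, map_pow, translate_X, translate_C, add_pow_char_pow, map_C, map_X,
    mul_add, Finset.sum_add_distrib]

end PowerFormOperations

section Coideals

variable {k : Type*} [Field k] {n : ℕ} (p : ℕ) [hp : Fact p.Prime] [CharP k p]

/-- If `f_j = powerForm (p ^ e j) (a j)` has the least exponent among the power forms of `I` with leading
variable `x_j`, then every power form in `I` lies in the ideal of the `f_j`: clear leading terms with
Frobenius powers of the `f_j`. -/
lemma powerForm_mem_span {I : Ideal (MvPolynomial (Fin n) k)} {e : Fin n → ℕ}
    {a : Fin n → Fin n → k} (h1 : ∀ j, a j j = 1) (h0 : ∀ j i, j < i → a j i = 0)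
    (hmem : ∀ j, powerForm (p ^ e j) (a j) ∈ I)
    (hmin : ∀ j s b, b j = 1 → (∀ i, j < i → b i = 0) → powerForm (p ^ s) b ∈ I → e j ≤ s)
    (s : ℕ) (b : Fin n → k) (hb : powerForm (p ^ s) b ∈ I) :
    powerForm (p ^ s) b ∈ Ideal.span (Set.range fun j => powerForm (p ^ e j) (a j)) := by
  suffices H : ∀ (t : ℕ) (b : Fin n → k), (∀ i : Fin n, t ≤ i → b i = 0) →
      powerForm (p ^ s) b ∈ I →
      powerForm (p ^ s) b ∈ Ideal.span (Set.range fun j => powerForm (p ^ e j) (a j)) from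
    H n b (fun i hi => absurd i.2 (by omega)) hb
  intro t
  induction t with
  | zero =>
    intro b hb0 _
    have : powerForm (p ^ s) b = 0 := by simp [powerForm, hb0]
    rw [this]
    exact zero_mem _
  | succ t ih =>
    intro b hb0 hb
    by_cases ht : t < n
    swap
    · exact ih b (fun i hi => absurd i.2 (by omega)) hb
    set j : Fin n := ⟨t, ht⟩ with hj
    by_cases hbj : b j = 0
    · refine ih b (fun i hi => ?_) hb
      rcases hi.lt_or_eq with h | h
      · exact hb0 i h
      · rw [show i = j from Fin.ext h.symm, hbj]
    have hes : e j ≤ s := by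
      refine hmin j s (fun i => 0 - -(b j)⁻¹ * b i) (by simp [hbj]) (fun i hi => ?_) ?_
      · rw [hb0 i (by simpa [hj, Fin.lt_def] using hi)]; simp
      · rw [powerForm_sub_C_mul]
        refine sub_mem ?_ (I.mul_mem_left _ hb)
        have : powerForm (p ^ s) (fun _ : Fin n => (0 : k)) = 0 := by simp [powerForm]
        rw [this]; exact zero_mem _
    have hpow : powerForm (p ^ e j) (a j) ^ p ^ (s - e j) =
        powerForm (p ^ s) (fun i => a j i ^ p ^ (s - e j)) := by
      rw [powerForm_pow, ← pow_add, Nat.add_sub_cancel' hes]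
    have hpos : p ^ (s - e j) ≠ 0 := pow_ne_zero _ hp.out.ne_zero
    have h2 := powerForm_sub_C_mul (p ^ s) b (fun i => a j i ^ p ^ (s - e j)) (b j)
    rw [← hpow] at h2
    have h3 := ih (fun i => b i - b j * a j i ^ p ^ (s - e j)) (fun i hi => by
      rcases hi.lt_or_eq with h | h
      · rw [hb0 i h, h0 j i (by simpa [hj, Fin.lt_def] using h), zero_pow hpos]; simp
      · rw [show i = j from Fin.ext h.symm, h1]; simp) (by
      rw [h2]
      exact sub_mem hb (I.mul_mem_left _ (I.pow_mem_of_mem (hmem j) _ (Nat.pos_of_ne_zero hpos))))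
    rw [h2] at h3
    have h4 : powerForm (p ^ e j) (a j) ^ p ^ (s - e j) ∈
        Ideal.span (Set.range fun j => powerForm (p ^ e j) (a j)) :=
      Ideal.pow_mem_of_mem _ (Ideal.subset_span (Set.mem_range_self j)) _
        (Nat.pos_of_ne_zero hpos)
    simpa using add_mem h3 (Ideal.mul_mem_left _ (C (b j)) h4)

lemma totalDegree_coeff_translate_lt {F : MvPolynomial (Fin n) k} {γ : Fin n →₀ ℕ} (hγ : γ ≠ 0) :
    coeff γ (translate F) = 0 ∨ (coeff γ (translate F)).totalDegree < F.totalDegree := by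
  rw [or_iff_not_imp_left]
  intro h
  obtain ⟨β, hβ, hβ'⟩ := Finset.exists_mem_eq_sup _ (support_nonempty.2 h)
    fun s => s.sum fun _ e => e
  change (coeff γ (translate F)).totalDegree = β.degree at hβ'
  have h1 := le_totalDegree (add_mem_support_of_coeff_coeff_translate (mem_support_iff.1 hβ))
  have h2 : 0 < γ.degree := by
    rw [Nat.pos_iff_ne_zero, Ne, Finsupp.degree_eq_zero_iff]
    exact hγ
  rw [hβ']
  have h3 : (β + γ).degree ≤ F.totalDegree := h1
  rw [map_add] at h3
  omega

/-- The homogeneous components of positive degree of an additive polynomial are power forms. -/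
lemma sub_constantCoeff_mem_of_additive {I J : Ideal (MvPolynomial (Fin n) k)}
    (hhom : I.IsHomogeneous (homogeneousSubmodule (Fin n) k))
    (hJ : ∀ s (b : Fin n → k), powerForm (p ^ s) b ∈ I → powerForm (p ^ s) b ∈ J)
    {F : MvPolynomial (Fin n) k}
    (hF : ∀ β γ : Fin n →₀ ℕ, β ≠ 0 → γ ≠ 0 → coeff β (coeff γ (translate F)) = 0)
    (hFI : F - C (constantCoeff F) ∈ I) : F - C (constantCoeff F) ∈ J := by
  classical
  set G := F - C (constantCoeff F) with hG
  have hsupp : ∀ α ∈ G.support, ∃ j e, α = Finsupp.single j (p ^ e) := by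
    intro α hα
    rw [mem_support_iff, hG, coeff_sub, coeff_C] at hα
    by_cases h : α = 0
    · subst h; simp [constantCoeff_eq] at hα
    · rw [if_neg (Ne.symm h), sub_zero] at hα
      exact support_of_additive p hF (mem_support_iff.2 hα) h
  rw [← sum_homogeneousComponent G]
  refine sum_mem fun d _ => ?_
  have hd : homogeneousComponent d G ∈ I := homogeneousComponent_mem_of_mem hhom hFI d
  by_cases hz : homogeneousComponent d G = 0
  · rw [hz]; exact zero_mem _
  obtain ⟨α, hα⟩ := support_nonempty.2 hz
  have hα' := mem_support_iff.1 hα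
  rw [coeff_homogeneousComponent] at hα'
  split_ifs at hα' with hdeg
  swap
  · exact absurd rfl hα'
  obtain ⟨j, s, rfl⟩ := hsupp α (mem_support_iff.2 hα')
  rw [Finsupp.degree_single] at hdeg
  subst hdeg
  have key : homogeneousComponent (p ^ s) G =
      powerForm (p ^ s) (fun i => coeff (Finsupp.single i (p ^ s)) G) := by
    have hps : p ^ s ≠ 0 := pow_ne_zero _ hp.out.ne_zero
    ext α
    by_cases h : ∃ i, α = Finsupp.single i (p ^ s)
    · obtain ⟨i, rfl⟩ := h
      rw [coeff_powerForm hps, coeff_homogeneousComponent, if_pos (Finsupp.degree_single _ _)]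
    · have hr : coeff α (powerForm (p ^ s) (fun i => coeff (Finsupp.single i (p ^ s)) G)) = 0 := by
        rw [powerForm, coeff_sum]
        refine Finset.sum_eq_zero fun i _ => ?_
        rw [coeff_C_mul, coeff_X_pow, if_neg (fun h' => h ⟨i, h'.symm⟩), mul_zero]
      rw [hr, coeff_homogeneousComponent]
      split_ifs with hdeg
      · by_contra hne
        obtain ⟨i, t, rfl⟩ := hsupp α (mem_support_iff.2 hne)
        rw [Finsupp.degree_single] at hdeg
        exact h ⟨i, by rw [hdeg]⟩
      · rfl
  rw [key] at hd ⊢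
  exact hJ _ _ hd

/-- Let `J ⊆ I` be the ideal of a triangular family of power forms containing all power forms of `I`.
If the Hasse derivatives of positive order of `F` are constants modulo `J`, then the remainder `G` of
`F` modulo `J` is additive up to a constant, so `F - F(0) ∈ I` implies `F - F(0) ∈ J`. -/
lemma sub_constantCoeff_mem_span {I : Ideal (MvPolynomial (Fin n) k)}
    (hhom : I.IsHomogeneous (homogeneousSubmodule (Fin n) k))
    {e : Fin n → ℕ} {a : Fin n → Fin n → k} (h1 : ∀ j, a j j = 1)
    (h0 : ∀ j i, j < i → a j i = 0) (hmem : ∀ j, powerForm (p ^ e j) (a j) ∈ I)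
    (hJ : ∀ s (b : Fin n → k), powerForm (p ^ s) b ∈ I →
      powerForm (p ^ s) b ∈ Ideal.span (Set.range fun j => powerForm (p ^ e j) (a j)))
    {F : MvPolynomial (Fin n) k} (hFI : F - C (constantCoeff F) ∈ I)
    (hF : ∀ γ : Fin n →₀ ℕ, γ ≠ 0 → coeff γ (translate F) - C (coeff γ F) ∈
      Ideal.span (Set.range fun j => powerForm (p ^ e j) (a j))) :
    F - C (constantCoeff F) ∈ Ideal.span (Set.range fun j => powerForm (p ^ e j) (a j)) := by
  set J := Ideal.span (Set.range fun j => powerForm (p ^ e j) (a j)) with hJdef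
  have hps : ∀ s, p ^ s ≠ 0 := fun s => pow_ne_zero _ hp.out.ne_zero
  have hq : ∀ j, 0 < p ^ e j := fun j => Nat.pos_of_ne_zero (hps _)
  have hJI : J ≤ I := Ideal.span_le.2 (by rintro _ ⟨j, rfl⟩; exact hmem j)
  have hJ0 : ∀ g ∈ J, constantCoeff g = 0 := by
    intro g hg
    have hle : J ≤ RingHom.ker (constantCoeff : MvPolynomial (Fin n) k →+* k) :=
      Ideal.span_le.2 (by rintro _ ⟨j, rfl⟩; exact constantCoeff_powerForm (hps _) _)
    exact hle hg
  obtain ⟨Q, _, π, hπ⟩ : ∃ (Q : Type _) (_ : CommRing Q) (π : MvPolynomial (Fin n) k →+* Q),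
      ∀ x, π x = 0 ↔ x ∈ J :=
    ⟨_, inferInstance, Ideal.Quotient.mk J, fun _ => Ideal.Quotient.eq_zero_iff_mem⟩
  let JQ : Ideal (MvPolynomial (Fin n) Q) :=
    Ideal.span (Set.range fun j => powerForm (p ^ e j) (fun i => π (C (a j i))))
  have hmapC : ∀ g ∈ J, map (π.comp C) g ∈ JQ := by
    intro g hg
    have hle : J ≤ JQ.comap (map (π.comp C)) := by
      refine Ideal.span_le.2 ?_
      rintro _ ⟨j, rfl⟩
      rw [SetLike.mem_coe, Ideal.mem_comap, map_powerForm]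
      exact Ideal.subset_span (Set.mem_range_self j)
    exact hle hg
  have htrans : ∀ g ∈ J, map π (translate g) ∈ JQ := by
    intro g hg
    have hle : J ≤ JQ.comap ((map π).comp
        (translate : MvPolynomial (Fin n) k →ₐ[k] _).toRingHom) := by
      refine Ideal.span_le.2 ?_
      rintro _ ⟨j, rfl⟩
      have hfj : powerForm (p ^ e j) (a j) ∈ J := Ideal.subset_span (Set.mem_range_self j)
      have h2 : map π (translate (powerForm (p ^ e j) (a j))) =
          map (π.comp C) (powerForm (p ^ e j) (a j)) := by
        rw [translate_powerForm, map_add, map_C, (hπ _).2 hfj, map_zero, zero_add, map_map]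
      change map π (translate (powerForm (p ^ e j) (a j))) ∈ JQ
      rw [h2]
      exact hmapC _ hfj
    exact hle hg
  obtain ⟨G, hGred, hFG⟩ := exists_isReduced (fun j => p ^ e j) hq a h1 h0 F
  have hG0 : constantCoeff G = constantCoeff F := by
    have := hJ0 _ hFG
    rw [map_sub, sub_eq_zero] at this
    exact this.symm
  -- `Ψ F` is `F(x + c) - F(x) - F(c) + F(0)` with `x` taken modulo `J`. It vanishes at `F` and maps
  -- `J` into the ideal of the `f_j(c)`, hence `Ψ G` lies there; as `Ψ G` is reduced, it is zero.
  let Ψ : MvPolynomial (Fin n) k → MvPolynomial (Fin n) Q := fun F =>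
    map π (translate F) - C (π F) - map (π.comp C) F + C (π (C (constantCoeff F)))
  have hΨ0 : ∀ F, coeff 0 (Ψ F) = 0 := by
    intro F
    simp [Ψ, coeff_map, constantCoeff_eq]
  have hΨ : ∀ F γ, γ ≠ 0 → coeff γ (Ψ F) = π (coeff γ (translate F) - C (coeff γ F)) := by
    intro F γ hγ
    simp [Ψ, coeff_map, coeff_C, Ne.symm hγ]
  have hΨF : Ψ F = 0 := by
    ext γ
    by_cases hγ : γ = 0
    · subst hγ; rw [hΨ0]; simp
    · rw [hΨ _ _ hγ, (hπ _).2 (hF γ hγ), coeff_zero]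
  have hΨG : Ψ G ∈ JQ := by
    have h2 : Ψ G = -(map π (translate (F - G)) - map (π.comp C) (F - G)) := by
      have h3 : Ψ F - Ψ G = map π (translate (F - G)) - C (π (F - G)) -
          map (π.comp C) (F - G) + C (π (C (constantCoeff (F - G)))) := by
        simp only [Ψ, map_sub]; ring
      rw [(hπ _).2 hFG, hJ0 _ hFG, hΨF] at h3
      simp only [map_zero, sub_zero, add_zero, zero_sub] at h3
      rw [← h3, neg_neg]
    rw [h2]
    exact neg_mem (sub_mem (htrans _ hFG) (hmapC _ hFG))
  have hΨG0 : Ψ G = 0 := by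
    refine IsReduced.eq_zero_of_mem (q := fun j => p ^ e j) hq
      (a := fun j i => π (C (a j i))) (fun j => by simp [h1])
      (fun j i hij => by simp [h0 j i hij]) ?_ hΨG
    intro γ hγ j
    by_cases hγ0 : γ = 0
    · subst hγ0; exact hq j
    rw [mem_support_iff, hΨ _ _ hγ0] at hγ
    have h2 : coeff γ (translate G) ≠ 0 := by
      intro h
      apply hγ
      have := coeff_zero_coeff_translate G γ
      rw [h, coeff_zero] at this
      rw [h, ← this]; simp
    obtain ⟨β, hβ⟩ := support_nonempty.2 h2
    have := hGred _ (add_mem_support_of_coeff_coeff_translate (mem_support_iff.1 hβ)) j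
    exact lt_of_le_of_lt (by simp) this
  -- The Hasse derivatives of `G` are themselves reduced, so constancy modulo `J` is constancy.
  have hadd : ∀ γ : Fin n →₀ ℕ, γ ≠ 0 → coeff γ (translate G) - C (coeff γ G) = 0 := by
    intro γ hγ
    refine IsReduced.eq_zero_of_mem (q := fun j => p ^ e j) hq (a := a) h1 h0 ?_ ?_
    · intro β hβ j
      by_cases hβ0 : β = 0
      · subst hβ0; exact hq j
      rw [mem_support_iff, coeff_sub, coeff_C, if_neg (Ne.symm hβ0), sub_zero] at hβ
      have := hGred _ (add_mem_support_of_coeff_coeff_translate hβ) j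
      exact lt_of_le_of_lt (by simp) this
    · rw [← hJdef, ← hπ, ← hΨ _ _ hγ, hΨG0, coeff_zero]
  have hGJ : G - C (constantCoeff G) ∈ J := by
    refine sub_constantCoeff_mem_of_additive p hhom hJ (fun β γ hβ hγ => ?_) ?_
    · rw [sub_eq_zero.1 (hadd γ hγ), coeff_C, if_neg (Ne.symm hβ)]
    · rw [hG0, show G - C (constantCoeff F) = (F - C (constantCoeff F)) - (F - G) by ring]
      exact sub_mem hFI (hJI hFG)
  rw [hG0] at hGJ
  rw [show F - C (constantCoeff F) = (F - G) + (G - C (constantCoeff F)) by ring]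
  exact add_mem hFG hGJ

/-- Let `A` be stable under all Hasse derivatives, and let the ideal `I` generated by the `F - F(0)`,
`F ∈ A`, be homogeneous and contain all `x_j ^ (p ^ E)`. Then `I` is generated by a triangular family
of power forms `f_j` of degrees `p ^ e j ≤ p ^ E`. -/
theorem exists_powerForm_generators {A : Set (MvPolynomial (Fin n) k)}
    (hA : ∀ F ∈ A, ∀ γ, coeff γ (translate F) ∈ A) {I : Ideal (MvPolynomial (Fin n) k)}
    (hI : I = Ideal.span ((fun F => F - C (constantCoeff F)) '' A))
    (hhom : I.IsHomogeneous (homogeneousSubmodule (Fin n) k)) {E : ℕ}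
    (hE : ∀ j, X j ^ p ^ E ∈ I) :
    ∃ (e : Fin n → ℕ) (a : Fin n → Fin n → k), (∀ j, e j ≤ E) ∧ (∀ j, a j j = 1) ∧
      (∀ j i, j < i → a j i = 0) ∧
      Ideal.span (Set.range fun j => powerForm (p ^ e j) (a j)) = I := by
  classical
  let P : Fin n → ℕ → Prop := fun j s =>
    ∃ b : Fin n → k, b j = 1 ∧ (∀ i, j < i → b i = 0) ∧ powerForm (p ^ s) b ∈ I
  have hPE : ∀ j, P j E := fun j => ⟨Pi.single j 1, by simp, fun i hi => by simp [hi.ne'], by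
    rw [powerForm_single]; exact hE j⟩
  have hP : ∀ j, ∃ s, P j s := fun j => ⟨E, hPE j⟩
  choose a h1 h0 hmem using fun j => Nat.find_spec (hP j)
  refine ⟨fun j => Nat.find (hP j), a, fun j => Nat.find_min' _ (hPE j), h1, h0, ?_⟩
  have hJ := powerForm_mem_span p h1 h0 hmem
    (fun j s b hb1 hb0 hb => Nat.find_min' (hP j) ⟨b, hb1, hb0, hb⟩)
  refine le_antisymm (Ideal.span_le.2 (by rintro _ ⟨j, rfl⟩; exact hmem j)) ?_
  have main : ∀ (N : ℕ), ∀ F ∈ A, F.totalDegree < N → F - C (constantCoeff F) ∈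
      Ideal.span (Set.range fun j => powerForm (p ^ Nat.find (hP j)) (a j)) := by
    intro N
    induction N with
    | zero => intro F _ h; omega
    | succ N ih =>
      intro F hF hN
      refine sub_constantCoeff_mem_span p hhom h1 h0 hmem hJ ?_ fun γ hγ => ?_
      · rw [hI]; exact Ideal.subset_span ⟨F, hF, rfl⟩
      · rcases totalDegree_coeff_translate_lt (F := F) hγ with h | h
        · have h2 := coeff_zero_coeff_translate F γ
          rw [h, coeff_zero] at h2
          rw [h, ← h2]; simp
        · have h2 := ih _ (hA F hF γ) (by omega)
          rwa [constantCoeff_eq, coeff_zero_coeff_translate] at h2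
  conv_lhs => rw [hI]
  refine Ideal.span_le.2 ?_
  rintro _ ⟨F, hF, rfl⟩
  exact main _ F hF (Nat.lt_succ_self _)

end Coideals

/-! ### Height and complete intersections -/

section Height

variable {k : Type*} [Field k] {n : ℕ}

/-- The substitution of `0` for the first `i` variables; its kernel is the prime `(x₁, …, x_i)`. -/
def killBelow (i : ℕ) : MvPolynomial (Fin n) k →ₐ[k] MvPolynomial (Fin n) k :=
  aeval fun j => if (j : ℕ) < i then 0 else X j

lemma le_height_ker_killBelow (i : ℕ) (hi : i ≤ n) :
    (i : ℕ∞) ≤ (RingHom.ker (killBelow i : MvPolynomial (Fin n) k →ₐ[k] _)).height := by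
  induction i with
  | zero => simp
  | succ i ih =>
    have hle : RingHom.ker (killBelow i : MvPolynomial (Fin n) k →ₐ[k] _) <
        RingHom.ker (killBelow (i + 1) : MvPolynomial (Fin n) k →ₐ[k] _) := by
      have hcomp : (killBelow (i + 1) : MvPolynomial (Fin n) k →ₐ[k] _) =
          (killBelow (i + 1)).comp (killBelow i) := by
        refine algHom_ext fun j => ?_
        by_cases h : (j : ℕ) < i
        · simp [killBelow, h, h.le]
        · simp [killBelow, h]
      refine lt_of_le_of_ne (fun f hf => ?_) fun h => ?_
      · rw [RingHom.mem_ker] at hf ⊢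
        rw [hcomp, AlgHom.comp_apply, hf, map_zero]
      · have h2 : (X (⟨i, hi⟩ : Fin n) : MvPolynomial (Fin n) k) ∈
            RingHom.ker (killBelow (i + 1) : MvPolynomial (Fin n) k →ₐ[k] _) := by
          simp [RingHom.mem_ker, killBelow]
        rw [← h, RingHom.mem_ker] at h2
        simp [killBelow] at h2
    have : (RingHom.ker (killBelow i : MvPolynomial (Fin n) k →ₐ[k] _)).IsPrime :=
      RingHom.ker_isPrime _
    have : (RingHom.ker (killBelow (i + 1) : MvPolynomial (Fin n) k →ₐ[k] _)).IsPrime :=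
      RingHom.ker_isPrime _
    push_cast
    exact (add_le_add_left (ih (by omega)) 1).trans
      (Ideal.height_add_one_le_of_lt_of_isPrime hle)

lemma ker_killBelow_le {P : Ideal (MvPolynomial (Fin n) k)} (hP : ∀ j, X j ∈ P) :
    RingHom.ker (killBelow n : MvPolynomial (Fin n) k →ₐ[k] _) ≤ P := by
  intro f hf
  have h0 : (killBelow n : MvPolynomial (Fin n) k →ₐ[k] _) f = C (constantCoeff f) := by
    have : (killBelow n : MvPolynomial (Fin n) k →ₐ[k] MvPolynomial (Fin n) k) =
        (Algebra.ofId k _).comp (aeval fun _ => 0) := by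
      refine algHom_ext fun j => ?_
      simp [killBelow]
    rw [this, AlgHom.comp_apply, aeval_zero']
    simp [Algebra.ofId_apply, algebraMap_eq]
  rw [RingHom.mem_ker, h0] at hf
  have hle : Ideal.span (X '' Set.univ) ≤ P :=
    Ideal.span_le.2 (by rintro _ ⟨j, _, rfl⟩; exact hP j)
  refine hle (mem_ideal_span_X_image.2 fun m hm => ?_)
  by_contra! h
  have hm0 : m = 0 := Finsupp.ext fun i => h i trivial
  rw [mem_support_iff, hm0, ← constantCoeff_eq] at hm
  exact hm (C_injective _ _ (by rw [hf, map_zero]))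

theorem le_height_of_X_pow_mem {I : Ideal (MvPolynomial (Fin n) k)} {m : ℕ}
    (hI : ∀ j, X j ^ m ∈ I) : (n : ℕ∞) ≤ I.height := by
  rw [Ideal.height_eq_inf_minimalPrimes]
  refine le_iInf₂ fun P hP => ?_
  have := hP.isPrime
  exact (le_height_ker_killBelow n le_rfl).trans (Ideal.height_mono
    (ker_killBelow_le fun j => this.mem_of_pow_mem _ (hP.le (hI j))))

lemma height_span_le_card {t : Finset (MvPolynomial (Fin n) k)}
    (ht : Ideal.span (t : Set (MvPolynomial (Fin n) k)) ≠ ⊤) :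
    (Ideal.span (t : Set (MvPolynomial (Fin n) k))).height ≤ t.card := by
  refine (Ideal.height_le_spanRank_toENat _ ht).trans ?_
  simpa using Submodule.spanRank_span_le_card (t : Set (MvPolynomial (Fin n) k))

/-- A proper homogeneous ideal of `k[x₁, …, xₙ]` that contains a power of each variable has height `n`;
by Krull's height theorem `n` generators of it form a minimal set of generators. -/
theorem isCompleteIntersection_of_X_pow_mem {I : Ideal (MvPolynomial (Fin n) k)} {m : ℕ}
    (hhom : I.IsHomogeneous (homogeneousSubmodule (Fin n) k)) (htop : I ≠ ⊤)
    (hX : ∀ j, X j ^ m ∈ I) (f : Fin n → MvPolynomial (Fin n) k)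
    (hf : Ideal.span (Set.range f) = I) : IsCompleteIntersection I := by
  classical
  have hn := le_height_of_X_pow_mem hX
  have hs : Ideal.span ((Finset.univ.image f : Finset _) : Set (MvPolynomial (Fin n) k)) = I := by
    rw [Finset.coe_image, Finset.coe_univ, Set.image_univ, hf]
  have hle : ∀ t : Finset (MvPolynomial (Fin n) k),
      Ideal.span (t : Set (MvPolynomial (Fin n) k)) = I → I.height ≤ t.card := by
    rintro t rfl
    exact height_span_le_card htop
  -- The `f j` need not be known to be distinct: the count follows from the height.
  have hcard : (Finset.univ.image f).card ≤ n := by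
    simpa using Finset.card_image_le (s := Finset.univ) (f := f)
  refine ⟨hhom, Finset.univ.image f, hs, fun t ht h => ?_, ?_⟩
  · have h1 := Finset.card_lt_card ht
    have h2 : (n : ℕ∞) ≤ t.card := hn.trans (hle t h)
    rw [Nat.cast_le] at h2
    omega
  · exact le_antisymm ((Nat.cast_le.2 hcard).trans hn) (hle _ hs)

end Height

/-! ### Invariants of automorphisms respecting levels of variables -/

section Levels

variable {k : Type*} [Field k] {n : ℕ} (lev : Fin n → ℕ)

/-- The substitution of `0` for the variables of level at least `l`. -/
def lowPart (l : ℕ) : MvPolynomial (Fin n) k →ₐ[k] MvPolynomial (Fin n) k :=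
  aeval fun j => if lev j < l then X j else 0

/-- The substitution of `0` for all variables outside level `l`. -/
def levelPart (l : ℕ) : MvPolynomial (Fin n) k →ₐ[k] MvPolynomial (Fin n) k :=
  aeval fun j => if lev j = l then X j else 0

/-- The translation `x_j ↦ x_j + c_j` of the variables of level `l` only. -/
def translateLevel (l : ℕ) :
    MvPolynomial (Fin n) k →ₐ[k] MvPolynomial (Fin n) (MvPolynomial (Fin n) k) :=
  aeval fun j => C (X j) + if lev j = l then X j else 0

/-- The linear forms in the variables of level less than `l`. -/
def lowForms (l : ℕ) : Submodule k (MvPolynomial (Fin n) k) :=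
  Submodule.span k (X '' {i | lev i < l})

variable {lev}

@[simp] lemma lowPart_X (l : ℕ) (j : Fin n) :
    lowPart lev l (X j : MvPolynomial (Fin n) k) = if lev j < l then X j else 0 := aeval_X _ _

@[simp] lemma levelPart_X (l : ℕ) (j : Fin n) :
    levelPart lev l (X j : MvPolynomial (Fin n) k) = if lev j = l then X j else 0 := aeval_X _ _

@[simp] lemma translateLevel_X (l : ℕ) (j : Fin n) :
    translateLevel lev l (X j : MvPolynomial (Fin n) k) =
      C (X j) + if lev j = l then X j else 0 := aeval_X _ _

lemma constantCoeff_lowPart (l : ℕ) (f : MvPolynomial (Fin n) k) :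
    constantCoeff (lowPart lev l f) = constantCoeff f := by
  have : (constantCoeff : MvPolynomial (Fin n) k →+* k).comp
      (lowPart lev l : _ →ₐ[k] MvPolynomial (Fin n) k).toRingHom = constantCoeff := by
    refine ringHom_ext (fun r => by simp [lowPart]) fun j => ?_
    by_cases h : lev j < l <;> simp [h]
  exact congrArg (fun φ : MvPolynomial (Fin n) k →+* k => φ f) this

lemma constantCoeff_levelPart (l : ℕ) (f : MvPolynomial (Fin n) k) :
    constantCoeff (levelPart lev l f) = constantCoeff f := by
  have : (constantCoeff : MvPolynomial (Fin n) k →+* k).comp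
      (levelPart lev l : _ →ₐ[k] MvPolynomial (Fin n) k).toRingHom = constantCoeff := by
    refine ringHom_ext (fun r => by simp [levelPart]) fun j => ?_
    by_cases h : lev j = l <;> simp [h]
  exact congrArg (fun φ : MvPolynomial (Fin n) k →+* k => φ f) this

lemma lowPart_lowPart (l : ℕ) (f : MvPolynomial (Fin n) k) :
    lowPart lev l (lowPart lev l f) = lowPart lev l f := by
  have : (lowPart lev l : MvPolynomial (Fin n) k →ₐ[k] _).comp (lowPart lev l) =
      lowPart lev l := by
    refine algHom_ext fun j => ?_
    by_cases h : lev j < l <;> simp [h]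
  exact DFunLike.congr_fun this f

lemma lowPart_of_mem_lowForms {l m : ℕ} (h : l ≤ m) {w : MvPolynomial (Fin n) k}
    (hw : w ∈ lowForms lev l) : lowPart lev m w = w := by
  refine LinearMap.eqOn_span (f := (lowPart lev m).toLinearMap) (g := LinearMap.id) ?_ hw
  rintro _ ⟨i, hi, rfl⟩
  have : lev i < m := lt_of_lt_of_le hi h
  simp [this]

lemma levelPart_of_mem_lowForms {l m : ℕ} (h : l ≤ m) {w : MvPolynomial (Fin n) k}
    (hw : w ∈ lowForms lev l) : levelPart lev m w = 0 := by
  refine LinearMap.eqOn_span (f := (levelPart lev m).toLinearMap) (g := 0) ?_ hw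
  rintro _ ⟨i, hi, rfl⟩
  have : lev i ≠ m := (lt_of_lt_of_le hi h).ne
  simp [this]

lemma translateLevel_of_mem_lowForms {l m : ℕ} (h : l ≤ m) {w : MvPolynomial (Fin n) k}
    (hw : w ∈ lowForms lev l) : translateLevel lev m w = C w := by
  refine LinearMap.eqOn_span (f := (translateLevel lev m).toLinearMap)
    (g := (IsScalarTower.toAlgHom k (MvPolynomial (Fin n) k)
      (MvPolynomial (Fin n) (MvPolynomial (Fin n) k))).toLinearMap) ?_ hw
  rintro _ ⟨i, hi, rfl⟩
  have : lev i ≠ m := (lt_of_lt_of_le hi h).ne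
  simp [this, algebraMap_eq]

lemma isHomogeneous_of_mem_lowForms {l : ℕ} {w : MvPolynomial (Fin n) k}
    (hw : w ∈ lowForms lev l) : w.IsHomogeneous 1 := by
  have hle : lowForms lev l ≤ homogeneousSubmodule (Fin n) k 1 := by
    refine Submodule.span_le.2 ?_
    rintro _ ⟨i, _, rfl⟩
    exact isHomogeneous_X _ _
  exact hle hw

variable (lev) in
/-- The endomorphism `φ` fixes every variable outside one level, and adds to each variable a linear form
in variables of lower levels. -/
structure IsLevelMap (φ : MvPolynomial (Fin n) k →ₐ[k] MvPolynomial (Fin n) k) : Prop where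
  sub_mem : ∀ j, φ (X j) - X j ∈ lowForms lev (lev j)
  exists_level : ∃ m, ∀ j, lev j ≠ m → φ (X j) = X j

/-- Killing the variables of level at least `l` preserves invariance under a level map `φ`: if `φ` moves
a level `m ≥ l` it fixes all of `lowPart l f`, and if `m < l` it commutes with `lowPart l`. -/
lemma IsLevelMap.map_lowPart {φ : MvPolynomial (Fin n) k →ₐ[k] MvPolynomial (Fin n) k}
    (hφ : IsLevelMap lev φ) (l : ℕ) {f : MvPolynomial (Fin n) k} (hf : φ f = f) :
    φ (lowPart lev l f) = lowPart lev l f := by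
  obtain ⟨m, hm⟩ := hφ.exists_level
  by_cases hlm : l ≤ m
  · have : φ.comp (lowPart lev l) = lowPart lev l := by
      refine algHom_ext fun j => ?_
      by_cases h : lev j < l
      · simp [h, hm j (by omega)]
      · simp [h]
    exact DFunLike.congr_fun this f
  · have : φ.comp (lowPart lev l) = (lowPart lev l).comp φ := by
      refine algHom_ext fun j => ?_
      have hj : φ (X j) = (φ (X j) - X j) + X j := by ring
      by_cases h : lev j < l
      · have h2 := lowPart_of_mem_lowForms h.le (hφ.sub_mem j)
        rw [map_sub, lowPart_X, if_pos h] at h2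
        simp only [AlgHom.comp_apply, lowPart_X, if_pos h]
        exact (sub_left_inj.1 h2).symm
      · simp [h, hm j (by omega)]
    have h2 := DFunLike.congr_fun this f
    simp only [AlgHom.comp_apply] at h2
    rw [h2, hf]

/-- For an invariant `f` in variables of level at most `l`, the coefficients of its translate along
level `l` are invariant, because `φ` changes the variables of level `l` only by lower ones. -/
lemma IsLevelMap.map_coeff_translateLevel
    {φ : MvPolynomial (Fin n) k →ₐ[k] MvPolynomial (Fin n) k}
    (hφ : IsLevelMap lev φ) {l : ℕ} {f : MvPolynomial (Fin n) k}
    (hl : lowPart lev (l + 1) f = f) (hf : φ f = f) (γ : Fin n →₀ ℕ) :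
    φ (coeff γ (translateLevel lev l f)) = coeff γ (translateLevel lev l f) := by
  have h1 : ((mapAlgHom φ).comp (translateLevel lev l)).comp (lowPart lev (l + 1)) =
      ((translateLevel lev l).comp φ).comp (lowPart lev (l + 1)) := by
    refine algHom_ext fun j => ?_
    by_cases h : lev j < l + 1
    · have h2 := translateLevel_of_mem_lowForms (show lev j ≤ l by omega) (hφ.sub_mem j)
      rw [map_sub, sub_eq_iff_eq_add] at h2
      simp only [AlgHom.comp_apply, lowPart_X, if_pos h, h2]
      by_cases h3 : lev j = l <;> simp [h3, ← add_assoc]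
    · simp [h]
  have h2 := DFunLike.congr_fun h1 f
  simp only [AlgHom.comp_apply, hl, hf] at h2
  have h3 := congrArg (coeff γ) h2
  simpa [coeff_map] using h3

lemma lowPart_coeff_translateLevel {l : ℕ} {f : MvPolynomial (Fin n) k}
    (hl : lowPart lev (l + 1) f = f) (γ : Fin n →₀ ℕ) :
    lowPart lev (l + 1) (coeff γ (translateLevel lev l f)) =
      coeff γ (translateLevel lev l f) := by
  have h1 : (mapAlgHom (lowPart lev (l + 1))).comp (translateLevel lev l) =
      (translateLevel lev l : MvPolynomial (Fin n) k →ₐ[k] _).comp (lowPart lev (l + 1)) := by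
    refine algHom_ext fun j => ?_
    by_cases h : lev j < l + 1
    · by_cases h3 : lev j = l <;> simp [h, h3]
    · have h3 : lev j ≠ l := by omega
      simp [h, h3]
  have h2 := DFunLike.congr_fun h1 f
  simp only [AlgHom.comp_apply, hl] at h2
  have h3 := congrArg (coeff γ) h2
  simpa [coeff_map] using h3

lemma translate_levelPart (l : ℕ) (f : MvPolynomial (Fin n) k) :
    translate (levelPart lev l f) = map (levelPart lev l : _ →ₐ[k] MvPolynomial (Fin n) k).toRingHom
      (translateLevel lev l f) := by
  have h1 : (translate : MvPolynomial (Fin n) k →ₐ[k] _).comp (levelPart lev l) =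
      (mapAlgHom (levelPart lev l)).comp (translateLevel lev l) := by
    refine algHom_ext fun j => ?_
    by_cases h : lev j = l <;> simp [h]
  exact DFunLike.congr_fun h1 f

lemma eval_X_map_lowPart (l : ℕ) (f : MvPolynomial (Fin n) k) :
    eval X (map (lowPart lev l : _ →ₐ[k] MvPolynomial (Fin n) k).toRingHom
      (translateLevel lev l f)) = lowPart lev (l + 1) f := by
  have h1 : ((eval X).comp (map (lowPart lev l : _ →ₐ[k] MvPolynomial (Fin n) k).toRingHom)).comp
      (translateLevel lev l : MvPolynomial (Fin n) k →ₐ[k] _).toRingHom =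
      (lowPart lev (l + 1) : _ →ₐ[k] MvPolynomial (Fin n) k).toRingHom := by
    refine ringHom_ext (fun r => by simp [translateLevel, lowPart, algebraMap_eq]) fun j => ?_
    rcases lt_trichotomy (lev j) l with h | h | h
    · simp [h, h.ne, h.trans (Nat.lt_succ_self l)]
    · simp [h]
    · simp [h.ne', h.not_gt, show ¬ lev j < l + 1 by omega]
  exact congrArg (fun φ : MvPolynomial (Fin n) k →+* MvPolynomial (Fin n) k => φ f) h1

lemma eval_X_map_constantCoeff (l : ℕ) (f : MvPolynomial (Fin n) k) :
    eval X (map (C.comp constantCoeff) (translateLevel lev l f)) = levelPart lev l f := by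
  have h1 : ((eval X).comp (map ((C : k →+* MvPolynomial (Fin n) k).comp constantCoeff))).comp
      (translateLevel lev l : MvPolynomial (Fin n) k →ₐ[k] _).toRingHom =
      (levelPart lev l : _ →ₐ[k] MvPolynomial (Fin n) k).toRingHom := by
    refine ringHom_ext (fun r => by simp [translateLevel, levelPart, algebraMap_eq]) fun j => ?_
    by_cases h : lev j = l <;> simp [h]
  exact congrArg (fun φ : MvPolynomial (Fin n) k →+* MvPolynomial (Fin n) k => φ f) h1

/-- The polynomials fixed by all maps in `Γ`. -/
def fixedPolys (Γ : Set (MvPolynomial (Fin n) k →ₐ[k] MvPolynomial (Fin n) k)) :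
    Set (MvPolynomial (Fin n) k) := {f | ∀ φ ∈ Γ, φ f = f}

variable {Γ : Set (MvPolynomial (Fin n) k →ₐ[k] MvPolynomial (Fin n) k)}

lemma C_mem_fixedPolys (r : k) : C r ∈ fixedPolys Γ := fun φ _ => φ.commutes r

lemma sub_C_mem_fixedPolys {f : MvPolynomial (Fin n) k} (hf : f ∈ fixedPolys Γ) (r : k) :
    f - C r ∈ fixedPolys Γ := fun φ hφ => by rw [map_sub, hf φ hφ, C_mem_fixedPolys r φ hφ]

/-- An invariant `f` in variables of level at most `l` is congruent to its part in the variables of level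
`l`, modulo the invariants of lower level without constant term. Indeed
`f(x, y) = ∑ D_γ(x, 0) y^γ`, where `y` are the variables of level `l`, and each `D_γ(x, 0)` is an
invariant of lower level. -/
lemma sub_levelPart_mem (hΓ : ∀ φ ∈ Γ, IsLevelMap lev φ) {l : ℕ} {f : MvPolynomial (Fin n) k}
    (hl : lowPart lev (l + 1) f = f) (hf : f ∈ fixedPolys Γ) :
    f - levelPart lev l f ∈
      Ideal.span {g | g ∈ fixedPolys Γ ∧ lowPart lev l g = g ∧ constantCoeff g = 0} := by
  set I := Ideal.span {g : MvPolynomial (Fin n) k |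
    g ∈ fixedPolys Γ ∧ lowPart lev l g = g ∧ constantCoeff g = 0}
  set P := map (lowPart lev l : _ →ₐ[k] MvPolynomial (Fin n) k).toRingHom
    (translateLevel lev l f) - map (C.comp constantCoeff) (translateLevel lev l f) with hP
  have h1 : f - levelPart lev l f = eval X P := by
    rw [hP, map_sub, eval_X_map_lowPart, eval_X_map_constantCoeff, hl]
  have h2 : P ∈ I.map C := by
    rw [mem_map_C_iff]
    intro γ
    rw [hP, coeff_sub, coeff_map, coeff_map]
    refine Ideal.subset_span ⟨?_, ?_, ?_⟩
    · exact sub_C_mem_fixedPolys (fun φ hφ => (hΓ φ hφ).map_lowPart l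
        ((hΓ φ hφ).map_coeff_translateLevel hl (hf φ hφ) γ)) _
    · change lowPart lev l (lowPart lev l _ - C _) = _
      rw [map_sub, lowPart_lowPart]
      congr 1
      exact (lowPart lev l).commutes _
    · change constantCoeff (lowPart lev l _ - C _) = _
      rw [map_sub, constantCoeff_lowPart, constantCoeff_C, sub_self]
  rw [h1]
  have h3 := Ideal.mem_map_of_mem (eval (X : Fin n → MvPolynomial (Fin n) k)) h2
  rw [Ideal.map_map] at h3
  have h4 : (eval (X : Fin n → MvPolynomial (Fin n) k)).comp C = RingHom.id _ := by
    ext <;> simp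
  rwa [h4, Ideal.map_id] at h3

variable (lev Γ) in
/-- The level-`l` parts of the invariants in variables of level at most `l`, for all `l`. -/
def levelParts : Set (MvPolynomial (Fin n) k) :=
  {F | ∃ l, ∃ f ∈ fixedPolys Γ, lowPart lev (l + 1) f = f ∧ F = levelPart lev l f}

/-- The family `levelParts` is stable under all Hasse derivatives. -/
lemma coeff_translate_mem_levelParts (hΓ : ∀ φ ∈ Γ, IsLevelMap lev φ) :
    ∀ F ∈ levelParts lev Γ, ∀ γ, coeff γ (translate F) ∈ levelParts lev Γ := by
  rintro _ ⟨l, f, hf, hl, rfl⟩ γ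
  refine ⟨l, coeff γ (translateLevel lev l f),
    fun φ hφ => (hΓ φ hφ).map_coeff_translateLevel hl (hf φ hφ) γ,
    lowPart_coeff_translateLevel hl γ, ?_⟩
  rw [translate_levelPart, coeff_map]
  rfl

/-- The Hilbert ideal is generated by the level parts of invariants, which are not invariant themselves. -/
lemma span_fixedPolys_eq_span_levelParts (hΓ : ∀ φ ∈ Γ, IsLevelMap lev φ) :
    Ideal.span {f | f ∈ fixedPolys Γ ∧ constantCoeff f = 0} =
      Ideal.span ((fun F => F - C (constantCoeff F)) '' levelParts lev Γ) := by
  apply le_antisymm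
  · set H := Ideal.span ((fun F => F - C (constantCoeff F)) '' levelParts lev Γ) with hH
    have key : ∀ l, Ideal.span {g : MvPolynomial (Fin n) k |
        g ∈ fixedPolys Γ ∧ lowPart lev l g = g ∧ constantCoeff g = 0} ≤ H := by
      intro l
      induction l with
      | zero =>
        refine Ideal.span_le.2 ?_
        rintro g ⟨-, hg, hg0⟩
        have h0 : (lowPart lev 0 : MvPolynomial (Fin n) k →ₐ[k] MvPolynomial (Fin n) k) =
            (Algebra.ofId k _).comp (aeval fun _ => 0) := by
          refine algHom_ext fun j => ?_
          simp
        rw [h0, AlgHom.comp_apply, aeval_zero', Algebra.algebraMap_self, RingHom.id_apply, hg0,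
          map_zero] at hg
        rw [← hg]
        exact zero_mem _
      | succ l ih =>
        refine Ideal.span_le.2 ?_
        rintro g ⟨hg, hl, hg0⟩
        have h1 := ih (sub_levelPart_mem hΓ hl hg)
        have h2 : levelPart lev l g - C (constantCoeff (levelPart lev l g)) ∈ H :=
          Ideal.subset_span ⟨_, ⟨l, g, hg, hl, rfl⟩, rfl⟩
        rw [constantCoeff_levelPart, hg0, map_zero, sub_zero] at h2
        simpa using add_mem h1 h2
    refine Ideal.span_le.2 ?_
    rintro f ⟨hf, hf0⟩
    refine key (Finset.univ.sup lev + 1) (Ideal.subset_span ⟨hf, ?_, hf0⟩)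
    have : (lowPart lev (Finset.univ.sup lev + 1) : MvPolynomial (Fin n) k →ₐ[k] _) =
        AlgHom.id k _ := by
      refine algHom_ext fun j => ?_
      have : lev j < Finset.univ.sup lev + 1 :=
        Nat.lt_succ_of_le (Finset.le_sup (f := lev) (Finset.mem_univ j))
      simp [this]
    rw [this]; rfl
  · refine Ideal.span_le.2 ?_
    rintro _ ⟨_, ⟨l, f, hf, hl, rfl⟩, rfl⟩
    have h1 := sub_levelPart_mem hΓ hl hf
    have h2 : Ideal.span {g : MvPolynomial (Fin n) k |
        g ∈ fixedPolys Γ ∧ lowPart lev l g = g ∧ constantCoeff g = 0} ≤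
        Ideal.span {f | f ∈ fixedPolys Γ ∧ constantCoeff f = 0} :=
      Ideal.span_mono fun g hg => ⟨hg.1, hg.2.2⟩
    have h3 : f - C (constantCoeff f) ∈ Ideal.span {f | f ∈ fixedPolys Γ ∧ constantCoeff f = 0} :=
      Ideal.subset_span ⟨sub_C_mem_fixedPolys hf _, by simp⟩
    have h4 := sub_mem h3 (h2 h1)
    simp only [constantCoeff_levelPart]
    rw [show f - C (constantCoeff f) - (f - levelPart lev l f) =
      levelPart lev l f - C (constantCoeff f) by ring] at h4
    exact h4

lemma map_homogeneousComponent {φ : MvPolynomial (Fin n) k →ₐ[k] MvPolynomial (Fin n) k}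
    (hφ : ∀ j, (φ (X j)).IsHomogeneous 1) (d : ℕ) (f : MvPolynomial (Fin n) k) :
    φ (homogeneousComponent d f) = homogeneousComponent d (φ f) := by
  have hφ' : φ = aeval fun j => φ (X j) := algHom_ext fun j => by simp
  have h1 : ∀ i, (φ (homogeneousComponent i f)).IsHomogeneous i := by
    intro i
    rw [hφ']
    simpa using (homogeneousComponent_isHomogeneous i f).aeval _ hφ
  conv_rhs => rw [← sum_homogeneousComponent f, map_sum, map_sum]
  rw [Finset.sum_congr rfl fun i _ => homogeneousComponent_of_mem (h1 i)]
  rw [Finset.sum_ite_eq]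
  split_ifs with h
  · rfl
  · rw [homogeneousComponent_eq_zero _ _ (by simpa using h), map_zero]

lemma isHomogeneous_span_fixedPolys (hΓ : ∀ φ ∈ Γ, ∀ j, (φ (X j)).IsHomogeneous 1) :
    (Ideal.span {f | f ∈ fixedPolys Γ ∧ constantCoeff f = 0}).IsHomogeneous
      (homogeneousSubmodule (Fin n) k) := by
  have h1 : Ideal.span {f | f ∈ fixedPolys Γ ∧ constantCoeff f = 0} =
      Ideal.span {f | (f ∈ fixedPolys Γ ∧ constantCoeff f = 0) ∧ ∃ d, f.IsHomogeneous d} := by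
    refine le_antisymm (Ideal.span_le.2 ?_) (Ideal.span_mono fun f hf => hf.1)
    rintro f ⟨hf, hf0⟩
    rw [SetLike.mem_coe, ← sum_homogeneousComponent f]
    refine sum_mem fun d _ => Ideal.subset_span ⟨⟨fun φ hφ => ?_, ?_⟩, d,
      homogeneousComponent_isHomogeneous d f⟩
    · rw [map_homogeneousComponent (hΓ φ hφ), hf φ hφ]
    · rw [constantCoeff_eq, coeff_homogeneousComponent] at *
      simp [hf0]
  rw [h1]
  refine Ideal.homogeneous_span _ _ fun f hf => ?_
  obtain ⟨_, d, hd⟩ := hf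
  exact ⟨d, hd⟩

end Levels

/-! ### Generalised Nakajima groups -/

section Action

variable {k V : Type*} [Field k] [AddCommGroup V] [Module k V] {n : ℕ}
  (B : Module.Basis (Fin n) k (Module.Dual k V))

lemma dualAct_one (x : Module.Dual k V) :
    dualAct (1 : LinearMap.GeneralLinearGroup k V) x = x := by
  ext v; simp [dualAct]

lemma dualAct_mul (g h : LinearMap.GeneralLinearGroup k V) (x : Module.Dual k V) :
    dualAct (g * h) x = dualAct g (dualAct h x) := by
  ext v; simp [dualAct]

/-- The contragredient action as a linear map. -/
def dualActₗ (g : LinearMap.GeneralLinearGroup k V) : Module.Dual k V →ₗ[k] Module.Dual k V :=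
  Module.Dual.transpose ((g⁻¹ : LinearMap.GeneralLinearGroup k V) : V →ₗ[k] V)

lemma dualActₗ_apply (g : LinearMap.GeneralLinearGroup k V) (x : Module.Dual k V) :
    dualActₗ g x = dualAct g x := rfl

lemma linearForm_basis (j : Fin n) : linearForm B (B j) = X j := by
  simp [linearForm]

lemma polyAct_X (g : LinearMap.GeneralLinearGroup k V) (j : Fin n) :
    polyAct B g (X j) = linearForm B (dualAct g (B j)) := aeval_X _ _

lemma polyAct_linearForm (g : LinearMap.GeneralLinearGroup k V) (x : Module.Dual k V) :
    polyAct B g (linearForm B x) = linearForm B (dualAct g x) := by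
  have : (polyAct B g).toLinearMap ∘ₗ linearForm B = linearForm B ∘ₗ dualActₗ g := by
    refine B.ext fun j => ?_
    simp [linearForm_basis, polyAct_X, dualActₗ_apply]
  exact LinearMap.congr_fun this x

lemma polyAct_mul (g h : LinearMap.GeneralLinearGroup k V) (f : MvPolynomial (Fin n) k) :
    polyAct B (g * h) f = polyAct B g (polyAct B h f) := by
  have : polyAct B (g * h) = (polyAct B g).comp (polyAct B h) := by
    refine algHom_ext fun j => ?_
    simp only [AlgHom.comp_apply, polyAct_X, polyAct_linearForm, dualAct_mul]
  exact DFunLike.congr_fun this f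

lemma polyAct_one (f : MvPolynomial (Fin n) k) :
    polyAct B (1 : LinearMap.GeneralLinearGroup k V) f = f := by
  have : polyAct B (1 : LinearMap.GeneralLinearGroup k V) = AlgHom.id k _ := by
    refine algHom_ext fun j => ?_
    simp [polyAct_X, dualAct_one, linearForm_basis]
  rw [this]; rfl

lemma mem_invariants_closure_iff (s : Set (LinearMap.GeneralLinearGroup k V))
    (f : MvPolynomial (Fin n) k) :
    f ∈ invariants (Subgroup.closure s) B ↔ f ∈ fixedPolys (polyAct B '' s) := by
  constructor
  · rintro hf _ ⟨g, hg, rfl⟩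
    exact hf g (Subgroup.subset_closure hg)
  · intro hf g hg
    induction hg using Subgroup.closure_induction with
    | mem g hg => exact hf _ ⟨g, hg, rfl⟩
    | one => exact polyAct_one B f
    | mul g h _ _ hg hh => rw [polyAct_mul, hh, hg]
    | inv g _ hg =>
      conv_lhs => rw [← hg]
      rw [← polyAct_mul, inv_mul_cancel, polyAct_one]

variable (lev : Fin n → ℕ)

/-- The span in `V^*` of the basis vectors of level less than `l`. -/
def lowSpan (l : ℕ) : Submodule k (Module.Dual k V) := Submodule.span k (B '' {i | lev i < l})

variable {lev B}

lemma linearForm_mem_lowForms {l : ℕ} {y : Module.Dual k V} (hy : y ∈ lowSpan B lev l) :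
    linearForm B y ∈ lowForms lev l := by
  have hle : lowSpan B lev l ≤ (lowForms lev l).comap (linearForm B) := by
    refine Submodule.span_le.2 ?_
    rintro _ ⟨i, hi, rfl⟩
    rw [SetLike.mem_coe, Submodule.mem_comap, linearForm_basis]
    exact Submodule.subset_span ⟨i, hi, rfl⟩
  exact hle hy

lemma dualAct_mem_lowSpan {g : LinearMap.GeneralLinearGroup k V} {l : ℕ}
    (hg : ∀ j, lev j < l → dualAct g (B j) - B j ∈ lowSpan B lev (lev j)) {y : Module.Dual k V}
    (hy : y ∈ lowSpan B lev l) : dualAct g y ∈ lowSpan B lev l := by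
  have hle : lowSpan B lev l ≤ (lowSpan B lev l).comap (dualActₗ g) := by
    refine Submodule.span_le.2 ?_
    rintro _ ⟨i, hi, rfl⟩
    rw [SetLike.mem_coe, Submodule.mem_comap, dualActₗ_apply, ← sub_add_cancel (dualAct g (B i))
      (B i)]
    refine add_mem ?_ (Submodule.subset_span ⟨i, hi, rfl⟩)
    exact Submodule.span_mono (Set.image_mono fun x (hx : lev x < lev i) => lt_trans hx hi)
      (hg i hi)
  exact hle hy

lemma dualAct_sub_mem_of_mem_closure {s : Set (LinearMap.GeneralLinearGroup k V)}
    (hs : ∀ g ∈ s, ∀ j, dualAct g (B j) - B j ∈ lowSpan B lev (lev j))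
    {g : LinearMap.GeneralLinearGroup k V} (hg : g ∈ Subgroup.closure s) :
    ∀ j, dualAct g (B j) - B j ∈ lowSpan B lev (lev j) := by
  induction hg using Subgroup.closure_induction with
  | mem g hg => exact hs g hg
  | one => intro j; simp [dualAct_one]
  | mul g h _ _ hg hh =>
    intro j
    have h1 : dualAct (g * h) (B j) - B j =
        dualAct g (dualAct h (B j) - B j) + (dualAct g (B j) - B j) := by
      rw [dualAct_mul]
      simp only [← dualActₗ_apply, map_sub]
      abel
    rw [h1]
    exact add_mem (dualAct_mem_lowSpan (fun i _ => hg i) (hh j)) (hg j)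
  | inv g _ hg =>
    -- Induction on levels: `g⁻¹ x_j - x_j = -g⁻¹ (g x_j - x_j)`, and `g x_j - x_j` has lower level.
    have key : ∀ l j, lev j < l → dualAct g⁻¹ (B j) - B j ∈ lowSpan B lev (lev j) := by
      intro l
      induction l with
      | zero => intro j hj; omega
      | succ l ih =>
        intro j hj
        have h1 : dualAct g⁻¹ (B j) - B j = -dualAct g⁻¹ (dualAct g (B j) - B j) := by
          simp only [← dualActₗ_apply, map_sub]
          simp only [dualActₗ_apply, ← dualAct_mul, inv_mul_cancel, dualAct_one]
          abel
        rw [h1]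
        exact neg_mem (dualAct_mem_lowSpan (fun i hi => ih i (by omega)) (hg j))
    exact fun j => key _ j (Nat.lt_succ_self _)

end Action

section Blocks

variable {k V : Type*} [Field k] [AddCommGroup V] [Module k V] {n r : ℕ}

/-- The level of `x_j`: the number of break points `i m` below its index. As `Fin n` counts from `0`, that
index is `j + 1`. -/
def level (i : Fin (r + 1) → ℕ) (j : Fin n) : ℕ :=
  (Finset.univ.filter fun m => i m < (j : ℕ) + 1).card

lemma lt_level_iff {i : Fin (r + 1) → ℕ} (hi : StrictMono i) (j : Fin n) (m : Fin (r + 1)) :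
    (m : ℕ) < level i j ↔ i m < (j : ℕ) + 1 := by
  constructor
  · intro h
    by_contra hcon
    have hsub : (Finset.univ.filter fun m => i m < (j : ℕ) + 1) ⊆ Finset.Iio m := by
      intro m' hm'
      have h1 := (Finset.mem_filter.1 hm').2
      exact Finset.mem_Iio.2 (hi.lt_iff_lt.1 (by omega))
    have := Finset.card_le_card hsub
    rw [Fin.card_Iio] at this
    exact absurd h (not_lt.2 this)
  · intro h
    have hsub : Finset.Iic m ⊆ (Finset.univ.filter fun m => i m < (j : ℕ) + 1) := by
      intro m' hm'
      exact Finset.mem_filter.2 ⟨Finset.mem_univ _,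
        (hi.monotone (Finset.mem_Iic.1 hm')).trans_lt h⟩
    have := Finset.card_le_card hsub
    rw [Fin.card_Iic] at this
    exact this

variable (B : Module.Basis (Fin n) k (Module.Dual k V))

/-- The generating set of `blockSubgroup G B a b`. -/
def blockSet (G : Subgroup (LinearMap.GeneralLinearGroup k V)) (a b : ℕ) :
    Set (LinearMap.GeneralLinearGroup k V) :=
  {g | g ∈ G ∧
    ∀ j : Fin n, dualAct g (B j) ≠ B j → (a < (j : ℕ) + 1 ∧ (j : ℕ) + 1 ≤ b) ∧ beta B g ≤ a}

variable {B} {G : Subgroup (LinearMap.GeneralLinearGroup k V)} {i : Fin (r + 1) → ℕ}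

lemma level_eq_of_ne (hi : StrictMono i) {m : Fin r} {g : LinearMap.GeneralLinearGroup k V}
    (hg : g ∈ blockSet B G (i m.castSucc) (i m.succ)) {j : Fin n} (hj : dualAct g (B j) ≠ B j) :
    level i j = m + 1 := by
  obtain ⟨⟨h1, h2⟩, -⟩ := hg.2 j hj
  have h3 := (lt_level_iff hi j m.castSucc).2 h1
  have h4 := (lt_level_iff hi j m.succ).not.2 (by omega)
  simp at h3 h4
  omega

lemma dualAct_sub_mem_of_mem_blockSet (hi : StrictMono i) {m : Fin r}
    {g : LinearMap.GeneralLinearGroup k V} (hg : g ∈ blockSet B G (i m.castSucc) (i m.succ))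
    (j : Fin n) : dualAct g (B j) - B j ∈ lowSpan B (level i) (level i j) := by
  by_cases hj : dualAct g (B j) = B j
  · rw [hj, sub_self]; exact zero_mem _
  rw [level_eq_of_ne hi hg hj, ← B.sum_repr (dualAct g (B j) - B j)]
  refine sum_mem fun l _ => ?_
  by_cases hl : B.repr (dualAct g (B j) - B j) l = 0
  · rw [hl, zero_smul]; exact zero_mem _
  refine Submodule.smul_mem _ _ (Submodule.subset_span ⟨l, ?_, rfl⟩)
  have h1 : (l : ℕ) + 1 ≤ beta B g := by
    classical
    unfold beta
    refine Finset.le_sup (f := fun j : Fin n => (j : ℕ) + 1) ?_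
    simp only [Finset.mem_filter, Finset.mem_univ, true_and]
    exact ⟨j, hl⟩
  have h2 := (hg.2 j hj).2
  have h3 := (lt_level_iff hi l m.castSucc).not.2 (by omega)
  simp at h3
  change level i l < m + 1
  omega

lemma isLevelMap_of_mem_blockSet (hi : StrictMono i) {m : Fin r}
    {g : LinearMap.GeneralLinearGroup k V} (hg : g ∈ blockSet B G (i m.castSucc) (i m.succ)) :
    IsLevelMap (level i) (polyAct B g) where
  sub_mem j := by
    rw [polyAct_X, ← linearForm_basis B j, ← map_sub]
    exact linearForm_mem_lowForms (dualAct_sub_mem_of_mem_blockSet hi hg j)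
  exists_level := by
    refine ⟨m + 1, fun j hj => ?_⟩
    have : dualAct g (B j) = B j := by
      by_contra h
      exact hj (level_eq_of_ne hi hg h)
    rw [polyAct_X, this, linearForm_basis]

end Blocks

section Norm

variable {k V : Type*} [Field k] [AddCommGroup V] [Module k V] {n : ℕ}
  {B : Module.Basis (Fin n) k (Module.Dual k V)} {G : Subgroup (LinearMap.GeneralLinearGroup k V)}

/-- The product of `g x_j` over all `g ∈ G` has level part `x_j ^ |G|`. -/
lemma exists_invariant_levelPart_eq_X_pow [Finite G] {lev : Fin n → ℕ}
    (hG : ∀ g ∈ G, ∀ j, polyAct B g (X j) - X j ∈ lowForms lev (lev j)) (j : Fin n) :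
    ∃ f ∈ invariants G B, lowPart lev (lev j + 1) f = f ∧
      levelPart lev (lev j) f = X j ^ Nat.card G := by
  classical
  have := Fintype.ofFinite G
  refine ⟨∏ g : G, polyAct B g.1 (X j), fun h hh => ?_, ?_, ?_⟩
  · rw [map_prod]
    refine Fintype.prod_equiv (Equiv.mulLeft (⟨h, hh⟩ : G)) _ _ fun g => ?_
    simp [polyAct_mul]
  · rw [map_prod]
    refine Finset.prod_congr rfl fun g _ => ?_
    have h1 := lowPart_of_mem_lowForms (Nat.le_succ _) (hG g.1 g.2 j)
    rw [map_sub, lowPart_X, if_pos (Nat.lt_succ_self _)] at h1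
    exact sub_left_inj.1 h1
  · rw [map_prod, Nat.card_eq_fintype_card, ← Finset.card_univ, ← Finset.prod_const]
    refine Finset.prod_congr rfl fun g _ => ?_
    have h1 := levelPart_of_mem_lowForms le_rfl (hG g.1 g.2 j)
    rw [map_sub, levelPart_X, if_pos rfl] at h1
    exact sub_eq_zero.1 h1

end Norm

end

end GenNakajima

section

attribute [local instance] MvPolynomial.gradedAlgebra

theorem theorem1p1 {k V : Type*} [Field k] [AddCommGroup V] [Module k V] [FiniteDimensional k V]
    (p : ℕ) [Fact p.Prime] [CharP k p]
    (G : Subgroup (LinearMap.GeneralLinearGroup k V)) [Finite G] (hG : IsPGroup p G)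
    {n : ℕ} (B : Module.Basis (Fin n) k (Module.Dual k V))
    (hN : GenNakajima.IsGeneralisedNakajima G B) :
    GenNakajima.IsCompleteIntersection (GenNakajima.hilbertIdeal G B) ∧
    ∃ f : Fin n → MvPolynomial (Fin n) k,
      Ideal.span (Set.range f) = GenNakajima.hilbertIdeal G B ∧
      ∀ j : Fin n,
        (f j).IsHomogeneous (f j).totalDegree ∧
        f j ∈ MvPolynomial.supported k {i : Fin n | i ≤ j} ∧
        (f j).totalDegree ≤ Nat.card G ∧
        MvPolynomial.coeff (Finsupp.single j (f j).totalDegree) (f j) ≠ 0 := by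
  open MvPolynomial GenNakajima in
  classical
  obtain ⟨r, i, -, hi, -, -, -, hgen⟩ := hN
  set s : Set (LinearMap.GeneralLinearGroup k V) :=
    ⋃ m : Fin r, blockSet B G (i m.castSucc) (i m.succ) with hs
  have hsG : Subgroup.closure s = G := by
    rw [← hgen, hs, Subgroup.closure_iUnion, Subgroup.closure_iUnion]
    refine iSup_congr fun m => ?_
    rw [Subgroup.closure_eq]
    rfl
  set lev : Fin n → ℕ := level i
  have hsub : ∀ g ∈ s, ∀ j, dualAct g (B j) - B j ∈ lowSpan B lev (lev j) := by
    intro g hg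
    obtain ⟨m, hm⟩ := Set.mem_iUnion.1 hg
    exact dualAct_sub_mem_of_mem_blockSet hi hm
  have hΓ : ∀ φ ∈ polyAct B '' s, IsLevelMap lev φ := by
    rintro _ ⟨g, hg, rfl⟩
    obtain ⟨m, hm⟩ := Set.mem_iUnion.1 hg
    exact isLevelMap_of_mem_blockSet hi hm
  have hinv : ∀ f, f ∈ invariants G B ↔ f ∈ fixedPolys (polyAct B '' s) := fun f => by
    have h := mem_invariants_closure_iff B s f
    rwa [hsG] at h
  have hH : hilbertIdeal G B =
      Ideal.span {f | f ∈ fixedPolys (polyAct B '' s) ∧ constantCoeff f = 0} := by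
    unfold hilbertIdeal
    simp only [hinv]
  have hspan := hH.trans (span_fixedPolys_eq_span_levelParts hΓ)
  have hhom : (hilbertIdeal G B).IsHomogeneous (homogeneousSubmodule (Fin n) k) := by
    rw [hH]
    refine isHomogeneous_span_fixedPolys fun φ hφ j => ?_
    rw [← sub_add_cancel (φ (X j)) (X j)]
    exact (isHomogeneous_of_mem_lowForms ((hΓ φ hφ).sub_mem j)).add (isHomogeneous_X _ _)
  have htop : hilbertIdeal G B ≠ ⊤ := by
    have hle : hilbertIdeal G B ≤ RingHom.ker (constantCoeff : MvPolynomial (Fin n) k →+* k) :=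
      Ideal.span_le.2 fun f hf => hf.2
    exact fun h => RingHom.ker_ne_top _ (top_le_iff.1 (h ▸ hle))
  have hX : ∀ j, X j ^ Nat.card G ∈ hilbertIdeal G B := by
    intro j
    obtain ⟨f, hf, hl, hfX⟩ := exists_invariant_levelPart_eq_X_pow (B := B) (G := G) (lev := lev)
      (fun g hg j => by
        rw [polyAct_X, ← linearForm_basis B j, ← map_sub]
        exact linearForm_mem_lowForms (dualAct_sub_mem_of_mem_closure hsub (hsG ▸ hg) j)) j
    have h1 : X j ^ Nat.card G - C (constantCoeff (X j ^ Nat.card G)) ∈ hilbertIdeal G B := by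
      rw [hspan, ← hfX]
      exact Ideal.subset_span ⟨_, ⟨_, f, (hinv f).1 hf, hl, rfl⟩, rfl⟩
    simpa [Nat.card_pos.ne'] using h1
  obtain ⟨E, hE⟩ := IsPGroup.iff_card.1 hG
  obtain ⟨e, a, he, h1, h0, hgens⟩ := exists_powerForm_generators p
    (coeff_translate_mem_levelParts hΓ) hspan hhom (hE ▸ hX)
  refine ⟨isCompleteIntersection_of_X_pow_mem hhom htop hX _ hgens, _, hgens, fun j => ?_⟩
  have hp : p ^ e j ≠ 0 := pow_ne_zero _ (Fact.out : p.Prime).ne_zero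
  have hc : coeff (Finsupp.single j (p ^ e j)) (powerForm (p ^ e j) (a j)) ≠ 0 := by
    rw [coeff_powerForm hp, h1]; exact one_ne_zero
  have hdeg : (powerForm (p ^ e j) (a j)).totalDegree = p ^ e j :=
    (powerForm_isHomogeneous _ _).totalDegree fun h => hc (by rw [h, coeff_zero])
  simp only [hdeg]
  refine ⟨powerForm_isHomogeneous _ _, sum_mem fun l _ => ?_, ?_, hc⟩
  · by_cases hl : j < l
    · rw [h0 j l hl, map_zero, zero_mul]; exact zero_mem _
    · refine mul_mem (Subalgebra.algebraMap_mem _ _) (pow_mem ?_ _)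
      exact X_mem_supported.2 (not_lt.1 hl)
  · rw [hE]
    exact Nat.pow_le_pow_right (Fact.out : p.Prime).pos (he j)

end
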